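/- Let $1\le p,q\le\infty$, let $n_1,\dots,n_k\ge 1$ be natural numbers, and let $d$ be their least common multiple. For an operator space $V$ (a closed subspace of some $B(H)$, with $M_r[V]\subseteq B(\ell_2^r\otimes H)$) put $M_n[V]=M_n\otimes_{\min}V$ and $S_1^n[V]=S_1^n\,\widehat\otimes\,V$ (operator space projective tensor product), where $S_1^n=M_n^*$ through the pairing $\langle A,B\rangle=\operatorname{tr}(AB^t)$. Define by complex interpolation $$S_q^n[V]=\big(M_n[V],S_1^n[V]\big)_{1/q},\qquad \ell_p^N[V]=\big(\ell_\infty^N[V],\ell_1^N[V]\big)_{1/p},$$ $$S_p^{n_1}[V]\oplus_p\cdots\oplus_p S_p^{n_k}[V]=\Big(M_{n_1}[V]\oplus_\infty\cdots\oplus_\infty M_{n_k}[V],\;S_1^{n_1}[V]\oplus_1\cdots\oplus_1S_1^{n_k}[V]\Big)_{1/p},$$ with the operator space structures $M_r[(V_0,V_1)_\theta]=(M_r[V_0],M_r[V_1])_\theta$, and omit $[V]$ when $V=\mathbb C$. Write $N=n_1^2+\cdots+n_k^2$ and $S_q^d(\ell_p^N[V])=S_q^d\big[\ell_p^N[V]\big]$.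 Then there exist a completely positive complete isometry (not necessarily onto) $$J:S_p^{n_1}\oplus_p\cdots\oplus_pS_p^{n_k}\longrightarrow S_q^d\big(\ell_p^{N}\big)$$ and a completely positive and completely contractive map $$W:S_q^d\big(\ell_p^{N}\big)\longrightarrow S_p^{n_1}\oplus_p\cdots\oplus_pS_p^{n_k}$$ with $W\circ J=\mathrm{id}$. Here complete positivity refers to the underlying C*-algebras $M_{n_1}\oplus\cdots\oplus M_{n_k}$ and $M_d(\ell_\infty^N)$. Moreover, the result holds in the vector-valued setting: for every operator space $E$, the map $$J\otimes\mathrm{id}_E:S_p^{n_1}[E]\oplus_p\cdots\oplus_pS_p^{n_k}[E]\longrightarrow S_q^d\big(\ell_p^{N}[E]\big)$$ is a complete isometry, the map $W\otimes\mathrm{id}_E$ in the opposite direction is completely contractive, and $(W\otimes\mathrm{id}_E)\circ(J\otimes\mathrm{id}_E)=\mathrm{id}$. In particular, $S_p^{n_1}[E]\oplus_p\cdots\oplus_pS_p^{n_k}[E]$ is completely isometric to a completely complemented subspace of $S_q^d(\ell_p^N[E])$, namely the range of $J\otimes\mathrm{id}_E$, which is the range of a completely contractive projection. -/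

import Mathlib

open scoped ENNReal

universe u v

namespace OpSpace

/-- A family of functions on all the spaces `M_ι[V]` of square matrices over `V`, `ι` a finite set:
the data of matrix norms. (Rows and columns may be labelled by any finite set; in an operator space
relabelling is isometric, so `ι` with `k` elements always stands for `M_k[V]`.) -/
def MatNorm (V : Type u) : Type (max u 1) :=
  ∀ (ι : Type) [Fintype ι], Matrix ι ι V → ℝ

/-! ### Complete contractions and complete isometries -/

section Maps

variable {V : Type u} [AddCommGroup V] [Module ℂ V] {W : Type v} [AddCommGroup W] [Module ℂ W]

/-- `‖T‖_cb ≤ 1`: every amplification `id ⊗ T : M_ι[V] → M_ι[W]` is a contraction. -/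
def CompletelyContractive (N : MatNorm V) (N' : MatNorm W) (T : V →ₗ[ℂ] W) : Prop :=
  ∀ (ι : Type) [Fintype ι] (x : Matrix ι ι V), N' ι (x.map T) ≤ N ι x

/-- Every amplification `id ⊗ T : M_ι[V] → M_ι[W]` is an isometry (not necessarily onto). -/
def CompleteIsometry (N : MatNorm V) (N' : MatNorm W) (T : V →ₗ[ℂ] W) : Prop :=
  ∀ (ι : Type) [Fintype ι] (x : Matrix ι ι V), N' ι (x.map T) = N ι x

/-- The completely bounded norm of `T`. -/
noncomputable def cbNorm (N : MatNorm V) (N' : MatNorm W) (T : V →ₗ[ℂ] W) : ℝ :=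
  sSup {r : ℝ | ∃ (m : ℕ) (x : Matrix (Fin m) (Fin m) V),
    N (Fin m) x ≤ 1 ∧ r = N' (Fin m) (x.map T)}

/-- `F` is the range of a completely contractive projection. -/
def CompletelyComplemented (N : MatNorm V) (F : Submodule ℂ V) : Prop :=
  ∃ P : V →ₗ[ℂ] V, CompletelyContractive N N P ∧ P ∘ₗ P = P ∧ LinearMap.range P = F

end Maps

/-! ### Scalars, concrete operator spaces, matrices over an operator space -/

open Classical in
/-- The norm of a complex matrix as an operator `ℓ₂^κ → ℓ₂^ι`. -/
noncomputable def opNorm {ι κ : Type} [Fintype ι] [Fintype κ] (A : Matrix ι κ ℂ) : ℝ :=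
  ‖(Matrix.toEuclideanLin A).toContinuousLinearMap‖

/-- The operator space `ℂ`: `M_ι[ℂ]` carries the operator norm. -/
noncomputable def scalarNorm : MatNorm ℂ := fun _ _ x => opNorm x

section Concrete

variable {H : Type u} [NormedAddCommGroup H] [InnerProductSpace ℂ H]

/-- A matrix `x` over `B(H)` as an operator on the Hilbert space `ℓ₂^ι ⊗ H = ℓ₂^ι(H)`:
`(x ξ)_i = ∑ j, x_{ij} ξ_j`. -/
noncomputable def blockOp {ι : Type} [Fintype ι] (x : Matrix ι ι (H →L[ℂ] H)) :
    PiLp 2 (fun _ : ι => H) →L[ℂ] PiLp 2 (fun _ : ι => H) :=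
  ((PiLp.continuousLinearEquiv 2 ℂ (fun _ : ι => H)).symm :
      (ι → H) →L[ℂ] PiLp 2 (fun _ : ι => H)) ∘L
    (ContinuousLinearMap.pi fun i => ∑ j, x i j ∘L ContinuousLinearMap.proj j) ∘L
    ((PiLp.continuousLinearEquiv 2 ℂ (fun _ : ι => H)) :
      PiLp 2 (fun _ : ι => H) →L[ℂ] (ι → H))

/-- The operator space structure of a subspace `E ⊆ B(H)`: `M_ι[E] ⊆ M_ι(B(H)) = B(ℓ₂^ι ⊗ H)`. -/
noncomputable def subspaceNorm (E : Submodule ℂ (H →L[ℂ] H)) : MatNorm E :=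
  fun _ _ x => ‖blockOp (x.map fun e : E => (e : H →L[ℂ] H))‖

end Concrete

/-- The operator space `M_n[V] = M_n ⊗_min V`, through `M_ι[M_n[V]] = M_{ι × n}[V]`. -/
def minNorm (n : Type) [Fintype n] {V : Type u} (N : MatNorm V) : MatNorm (n → n → V) :=
  fun ι _ x => N (ι × n) (Matrix.of fun r s => x r.1 s.1 r.2 s.2)

/-! ### The trace class and the projective tensor product with it -/

/-- For `x` in `M_ι ⊗ M_n`, the map `M_n → M_ι`, `C ↦ (⟨x_{rs}, C⟩)_{rs}`, with
`⟨B, C⟩ = tr (B Cᵗ) = ∑ B_{ab} C_{ab}`. -/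
noncomputable def pairing {n ι : Type} [Fintype n] (x : Matrix ι ι (n → n → ℂ)) :
    (n → n → ℂ) →ₗ[ℂ] (ι → ι → ℂ) where
  toFun C := fun r s => ∑ a, ∑ b, x r s a b * C a b
  map_add' C D := by
    funext r s
    simp [mul_add, Finset.sum_add_distrib]
  map_smul' c C := by
    funext r s
    simp [Finset.mul_sum, mul_left_comm]

/-- The operator space `S_1^n = (M_n)^*`: `M_ι[S_1^n] = CB(M_n, M_ι)`. -/
noncomputable def traceNorm (n : Type) [Fintype n] : MatNorm (n → n → ℂ) :=
  fun ι _ x => cbNorm (minNorm n scalarNorm) (minNorm ι scalarNorm) (pairing x)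

/-- The operator space projective tensor product `S_1^n[V] = S_1^n ⊗^ V`, on the vector space
`M_n ⊗ V = M_n(V)`: the norm of `t` in `M_ι[S_1^n ⊗^ V]` is the infimum of
`‖α‖ ‖x‖ ‖y‖ ‖β‖` over all representations `t = α (x ⊗ y) β` with `x` in `M_l[S_1^n]`,
`y` in `M_m[V]` and scalar rectangular matrices `α`, `β`. -/
noncomputable def projNorm (n : Type) [Fintype n] {V : Type u} [AddCommGroup V] [Module ℂ V]
    (N : MatNorm V) : MatNorm (n → n → V) :=
  fun ι _ t => sInf {c : ℝ | ∃ (l m : ℕ)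
    (α : Matrix ι (Fin l × Fin m) ℂ) (β : Matrix (Fin l × Fin m) ι ℂ)
    (x : Matrix (Fin l) (Fin l) (n → n → ℂ)) (y : Matrix (Fin m) (Fin m) V),
    (∀ (r s : ι) (a b : n), t r s a b =
      ∑ i, ∑ g, ∑ j, ∑ h, (α r (i, g) * x i j a b * β (j, h) s) • y g h) ∧
    c = opNorm α * traceNorm n (Fin l) x * N (Fin m) y * opNorm β}

/-! ### Complex interpolation -/

section Interpolation

variable {V : Type u} [NormedAddCommGroup V] [NormedSpace ℂ V]

/-- `f` is a bounded continuous function on the closed strip `0 ≤ Re z ≤ 1` with values in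
`M_ι[V]`, analytic in the open strip, with `‖f(it)‖₀ ≤ C` and `‖f(1+it)‖₁ ≤ C` for all real `t`. -/
def IsAdmissible (N₀ N₁ : MatNorm V) (ι : Type) [Fintype ι] (f : ℂ → ι → ι → V) (C : ℝ) : Prop :=
  DiffContOnCl ℂ f {z : ℂ | 0 < z.re ∧ z.re < 1} ∧
  (∃ B : ℝ, ∀ z : ℂ, 0 ≤ z.re → z.re ≤ 1 → ‖f z‖ ≤ B) ∧
  (∀ t : ℝ, N₀ ι (Matrix.of (f (t * Complex.I))) ≤ C) ∧
  (∀ t : ℝ, N₁ ι (Matrix.of (f (1 + t * Complex.I))) ≤ C)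

/-- The complex interpolation space `(V₀, V₁)_θ` with the operator space structure
`M_ι[(V₀, V₁)_θ] = (M_ι[V₀], M_ι[V₁])_θ`, for two operator space structures on one vector space
`V` that are, level by level, equivalent to the given norm of `V` (applied entrywise); this norm is
used only for its topology and bounded sets, which are those of `V₀ + V₁`.
For `θ = 0` and `θ = 1` this gives back `V₀` and `V₁`. -/
noncomputable def interp (θ : ℝ) (N₀ N₁ : MatNorm V) : MatNorm V :=
  fun ι _ x => sInf {C : ℝ | ∃ f : ℂ → ι → ι → V,
    IsAdmissible N₀ N₁ ι f C ∧ Matrix.of (f (θ : ℂ)) = x}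

/-- `S_q^n[V] = (M_n[V], S_1^n[V])_{1/q}`. -/
noncomputable def schattenNorm (q : ℝ≥0∞) (n : Type) [Fintype n] (N : MatNorm V) :
    MatNorm (n → n → V) :=
  interp q⁻¹.toReal (minNorm n N) (projNorm n N)

end Interpolation

/-! ### Direct sums -/

section Sums

variable {κ : Type} [Fintype κ] {V : κ → Type u}

/-- The `ℓ_∞`-direct sum of operator spaces. -/
noncomputable def sumInftyNorm (N : ∀ i, MatNorm (V i)) : MatNorm (∀ i, V i) :=
  fun ι _ x => ⨆ i, N i ι (Matrix.of fun r s => x r s i)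

/-- The `ℓ_1`-direct sum of operator spaces, that is, their coproduct: the norm of `x = ⊕ x_i` in
`M_ι[⊕_1 V_i]` is the supremum of `‖∑ (id ⊗ u_i)(x_i)‖` over all `m` and all families of complete
contractions `u_i : V_i → M_m`. -/
noncomputable def sumOneNorm [∀ i, AddCommGroup (V i)] [∀ i, Module ℂ (V i)]
    (N : ∀ i, MatNorm (V i)) : MatNorm (∀ i, V i) :=
  fun ι _ x => sSup {c : ℝ | ∃ (m : ℕ) (φ : ∀ i, V i →ₗ[ℂ] (Fin m → Fin m → ℂ)),
    (∀ i, CompletelyContractive (N i) (minNorm (Fin m) scalarNorm) (φ i)) ∧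
    c = minNorm (Fin m) scalarNorm ι (Matrix.of fun r s => ∑ i, φ i (x r s i))}

/-- The `p`-direct sum of the interpolation spaces `(V_i⁰, V_i¹)_{1/p}`, by interpolation:
`(⊕_∞ V_i⁰, ⊕_1 V_i¹)_{1/p}`. -/
noncomputable def sumNorm (p : ℝ≥0∞) [∀ i, NormedAddCommGroup (V i)] [∀ i, NormedSpace ℂ (V i)]
    (N₀ N₁ : ∀ i, MatNorm (V i)) : MatNorm (∀ i, V i) :=
  interp p⁻¹.toReal (sumInftyNorm N₀) (sumOneNorm N₁)

end Sums

section Spaces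

variable {V : Type u} [NormedAddCommGroup V] [NormedSpace ℂ V]

/-- The vector space `M_{n_1}(V) ⊕ ⋯ ⊕ M_{n_k}(V)`. -/
abbrev BlockSum {k : ℕ} (n : Fin k → ℕ) (V : Type u) : Type u :=
  ∀ i : Fin k, Fin (n i) → Fin (n i) → V

/-- `S_p^{n_1}[V] ⊕_p ⋯ ⊕_p S_p^{n_k}[V]
= (M_{n_1}[V] ⊕_∞ ⋯ ⊕_∞ M_{n_k}[V], S_1^{n_1}[V] ⊕_1 ⋯ ⊕_1 S_1^{n_k}[V])_{1/p}`. -/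
noncomputable def schattenSumNorm (p : ℝ≥0∞) {k : ℕ} (n : Fin k → ℕ) (N : MatNorm V) :
    MatNorm (BlockSum n V) :=
  sumNorm p (fun i => minNorm (Fin (n i)) N) (fun i => projNorm (Fin (n i)) N)

/-- `ℓ_p^m[V] = (ℓ_∞^m[V], ℓ_1^m[V])_{1/p}`. -/
noncomputable def ellNorm (p : ℝ≥0∞) (m : ℕ) (N : MatNorm V) : MatNorm (Fin m → V) :=
  sumNorm p (fun _ => N) (fun _ => N)

/-- The vector space `M_d(ℓ^m(V))`. -/
abbrev MatEll (d m : ℕ) (V : Type u) : Type u := Fin d → Fin d → Fin m → V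

/-- `S_q^d(ℓ_p^m[V])`. -/
noncomputable def schattenEllNorm (q p : ℝ≥0∞) (d m : ℕ) (N : MatNorm V) :
    MatNorm (MatEll d m V) :=
  schattenNorm q (Fin d) (ellNorm p m N)

end Spaces

/-! ### Complete positivity -/

/-- A family of subsets of the spaces `M_ι[V]`: the data of matrix cones. -/
def MatCone (V : Type u) : Type (max u 1) :=
  ∀ (ι : Type) [Fintype ι], Set (Matrix ι ι V)

/-- Every amplification `id ⊗ T : M_ι[V] → M_ι[W]` preserves positivity. -/
def CompletelyPositive {V W : Type} [AddCommGroup V] [Module ℂ V] [AddCommGroup W] [Module ℂ W]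
    (P : MatCone V) (Q : MatCone W) (T : V →ₗ[ℂ] W) : Prop :=
  ∀ (ι : Type) [Fintype ι], ∀ x ∈ P ι, x.map T ∈ Q ι

open scoped ComplexOrder in
/-- The positive elements of the C*-algebras `M_ι(M_{n_1} ⊕ ⋯ ⊕ M_{n_k}) = ⊕_i M_{ι × n_i}`. -/
def blockSumCone {k : ℕ} (n : Fin k → ℕ) : MatCone (BlockSum n ℂ) :=
  fun ι _ => {x | ∀ i, Matrix.PosSemidef
    (Matrix.of fun r s : ι × Fin (n i) => x r.1 s.1 i r.2 s.2)}

open scoped ComplexOrder in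
/-- The positive elements of the C*-algebras `M_ι(M_d(ℓ_∞^m)) = ⊕_{j ≤ m} M_{ι × d}`. -/
def matEllCone (d m : ℕ) : MatCone (MatEll d m ℂ) :=
  fun ι _ => {y | ∀ j, Matrix.PosSemidef
    (Matrix.of fun r s : ι × Fin d => y r.1 s.1 r.2 s.2 j)}

end OpSpace

open OpSpace

/-!
For `n ∣ d`, the `n²` Weyl operators on `ℂⁿ`, each amplified by `d / n`, give families
`(A_{s,k})_k`, `s ≤ n²`, of isometries `ℂⁿ → ℂ^d` with orthogonal ranges, and all the `A_{s,k}` are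
trace-orthogonal. Hence `x ↦ (∑_k A_{s,k} x_i A_{s,k}ᴴ)_{i,s}` is completely contractive into
`M_d(ℓ_∞^N)` by orthogonality of ranges, and from `S_1^{n_1} ⊕_1 ⋯ ⊕_1 S_1^{n_k}` into `M_d(ℓ_1^N)`,
up to the factors `1 / n_i`, by trace-orthogonality. Stein interpolation with the weights
`n_i^{-z}` gives a complete contraction from the `p`-sum into `M_d(ℓ_p^N)`; in the same way, its
adjoint, with the weights `n_i^{z-1}`, is completely contractive on `S_1^d(ℓ_p^N)`. The identity
`M_d[V] → S_1^d[V]` has completely bounded norm at most `d`, so that at the cost of the factors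
`d^{-1/q}` and `d^{1/q-1}` both `M_d` and `S_1^d` can be replaced by `S_q^d`. The composition of the
two maps is the identity because there are `n_i² · d / n_i = n_i d` isometries in the `i`-th block.
-/

namespace OpSpace

section OperatorNorm

open Matrix
open scoped Matrix.Norms.L2Operator Kronecker

variable {ι κ l ι' κ' : Type} [Fintype ι] [Fintype κ] [Fintype l] [Fintype ι'] [Fintype κ']

theorem opNorm_eq_norm [DecidableEq κ] (A : Matrix ι κ ℂ) : opNorm A = ‖A‖ := by
  rw [l2_opNorm_def]
  unfold opNorm
  congr!

theorem opNorm_nonneg (A : Matrix ι κ ℂ) : 0 ≤ opNorm A := norm_nonneg _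

theorem opNorm_mul_le (A : Matrix ι κ ℂ) (B : Matrix κ l ℂ) :
    opNorm (A * B) ≤ opNorm A * opNorm B := by
  classical
  simpa only [opNorm_eq_norm] using l2_opNorm_mul A B

theorem opNorm_conjTranspose (A : Matrix ι κ ℂ) : opNorm Aᴴ = opNorm A := by
  classical
  simpa only [opNorm_eq_norm] using l2_opNorm_conjTranspose A

theorem opNorm_add_le (A B : Matrix ι κ ℂ) : opNorm (A + B) ≤ opNorm A + opNorm B := by
  classical
  simpa only [opNorm_eq_norm] using norm_add_le A B

theorem opNorm_smul (c : ℂ) (A : Matrix ι κ ℂ) : opNorm (c • A) = ‖c‖ * opNorm A := by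
  classical
  simpa only [opNorm_eq_norm] using norm_smul c A

theorem opNorm_sum_le {σ : Type*} (s : Finset σ) (A : σ → Matrix ι κ ℂ) :
    opNorm (∑ i ∈ s, A i) ≤ ∑ i ∈ s, opNorm (A i) := by
  classical
  simpa only [opNorm_eq_norm] using norm_sum_le s A

theorem opNorm_mul_mul_le (A : Matrix ι κ ℂ) (X : Matrix κ l ℂ) (B : Matrix l ι' ℂ) :
    opNorm (A * X * B) ≤ opNorm A * opNorm X * opNorm B :=
  (opNorm_mul_le _ _).trans (mul_le_mul_of_nonneg_right (opNorm_mul_le _ _) (opNorm_nonneg _))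

theorem opNorm_sq_le_of_conjTranspose_mul_self [DecidableEq κ] {A : Matrix ι κ ℂ} {c : ℂ}
    (h : Aᴴ * A = c • 1) : opNorm A ^ 2 ≤ ‖c‖ := by
  have h1 : ‖(1 : Matrix κ κ ℂ)‖ ≤ 1 := by
    rw [← diagonal_one, l2_opNorm_diagonal]
    exact (pi_norm_le_iff_of_nonneg zero_le_one).2 fun _ => by simp
  calc opNorm A ^ 2 = ‖Aᴴ * A‖ := by rw [l2_opNorm_conjTranspose_mul_self, opNorm_eq_norm, sq]
    _ = ‖c‖ * ‖(1 : Matrix κ κ ℂ)‖ := by rw [h, norm_smul]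
    _ ≤ ‖c‖ := mul_le_of_le_one_right (norm_nonneg c) h1

theorem opNorm_le_one_of_conjTranspose_mul_self [DecidableEq κ] {A : Matrix ι κ ℂ}
    (h : Aᴴ * A = 1) : opNorm A ≤ 1 := by
  have := opNorm_sq_le_of_conjTranspose_mul_self (c := 1) (by rwa [one_smul])
  rw [norm_one] at this
  exact (sq_le_one_iff₀ (opNorm_nonneg A)).1 this

theorem opNorm_submatrix_le (A : Matrix ι κ ℂ) {e : ι' → ι} {f : κ' → κ}
    (he : Function.Injective e) (hf : Function.Injective f) :
    opNorm (A.submatrix e f) ≤ opNorm A := by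
  classical
  have incl {a b : Type} [Fintype a] [Fintype b] [DecidableEq a] {g : b → a}
      (hg : Function.Injective g) : opNorm ((1 : Matrix a a ℂ).submatrix id g) ≤ 1 := by
    classical
    refine opNorm_le_one_of_conjTranspose_mul_self ?_
    rw [conjTranspose_submatrix, conjTranspose_one, ← submatrix_mul _ _ _ _ _ Function.bijective_id,
      mul_one, submatrix_one g hg]
  have factor : A.submatrix e f =
      ((1 : Matrix ι ι ℂ).submatrix id e)ᴴ * A * (1 : Matrix κ κ ℂ).submatrix id f := by
    ext i j
    simp [mul_apply, one_apply]
  calc opNorm (A.submatrix e f)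
      ≤ opNorm ((1 : Matrix ι ι ℂ).submatrix id e)ᴴ * opNorm A *
          opNorm ((1 : Matrix κ κ ℂ).submatrix id f) := factor ▸ opNorm_mul_mul_le _ _ _
    _ ≤ 1 * opNorm A * 1 := by
        rw [opNorm_conjTranspose]
        have := opNorm_nonneg A
        gcongr
        exacts [opNorm_nonneg _, incl he, incl hf]
    _ = opNorm A := by ring

theorem opNorm_submatrix (A : Matrix ι κ ℂ) (e : ι' ≃ ι) (f : κ' ≃ κ) :
    opNorm (A.submatrix e f) = opNorm A := by
  refine le_antisymm (opNorm_submatrix_le A e.injective f.injective) ?_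
  simpa using opNorm_submatrix_le (A.submatrix e f) e.symm.injective f.symm.injective

theorem norm_toLp_mulVec_le (A : Matrix ι κ ℂ) (v : EuclideanSpace ℂ κ) :
    ‖WithLp.toLp 2 (A *ᵥ v)‖ ≤ opNorm A * ‖v‖ := by
  classical
  rw [opNorm_eq_norm]
  exact l2_opNorm_mulVec A v

theorem sum_norm_mulVec_sq_le (A : Matrix ι κ ℂ) (v : κ → ℂ) :
    ∑ i, ‖(A *ᵥ v) i‖ ^ 2 ≤ opNorm A ^ 2 * ∑ j, ‖v j‖ ^ 2 := by
  have := pow_le_pow_left₀ (norm_nonneg _) (norm_toLp_mulVec_le A (WithLp.toLp 2 v)) 2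
  rwa [mul_pow, EuclideanSpace.norm_sq_eq, EuclideanSpace.norm_sq_eq] at this

theorem opNorm_le_of_mulVec {A : Matrix ι κ ℂ} {C : ℝ} (hC : 0 ≤ C)
    (h : ∀ v : κ → ℂ, ∑ i, ‖(A *ᵥ v) i‖ ^ 2 ≤ C ^ 2 * ∑ j, ‖v j‖ ^ 2) : opNorm A ≤ C := by
  classical
  refine ContinuousLinearMap.opNorm_le_bound _ hC fun v => ?_
  refine (sq_le_sq₀ (norm_nonneg _) (by positivity)).1 ?_
  rw [mul_pow, EuclideanSpace.norm_sq_eq, EuclideanSpace.norm_sq_eq]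
  exact h v

theorem opNorm_blockDiagonal_le {σ : Type} [Fintype σ] [DecidableEq σ] {Y : σ → Matrix ι κ ℂ}
    {C : ℝ} (hC : 0 ≤ C) (hY : ∀ s, opNorm (Y s) ≤ C) : opNorm (blockDiagonal Y) ≤ C := by
  refine opNorm_le_of_mulVec hC fun v => ?_
  have hblock (i : ι) (s : σ) :
      (blockDiagonal Y *ᵥ v) (i, s) = (Y s *ᵥ fun j => v (j, s)) i := by
    simp [mulVec, dotProduct, Fintype.sum_prod_type, blockDiagonal_apply]
  calc ∑ r, ‖(blockDiagonal Y *ᵥ v) r‖ ^ 2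
      = ∑ s, ∑ i, ‖(Y s *ᵥ fun j => v (j, s)) i‖ ^ 2 := by
        simp only [Fintype.sum_prod_type_right, hblock]
    _ ≤ ∑ s, C ^ 2 * ∑ j, ‖v (j, s)‖ ^ 2 := by
        refine Finset.sum_le_sum fun s _ => (sum_norm_mulVec_sq_le _ _).trans ?_
        gcongr
        exacts [opNorm_nonneg _, hY s]
    _ = C ^ 2 * ∑ r, ‖v r‖ ^ 2 := by rw [Fintype.sum_prod_type_right, Finset.mul_sum]

omit [Fintype ι] [Fintype κ'] in
theorem one_kronecker_mul_mul_apply [DecidableEq l] (A : Matrix ι κ ℂ)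
    (X : Matrix (l × κ) (l × ι') ℂ) (B : Matrix ι' κ' ℂ) (p : l × ι) (q : l × κ') :
    ((1 : Matrix l l ℂ) ⊗ₖ A * X * (1 : Matrix l l ℂ) ⊗ₖ B) p q =
      ∑ a, ∑ b, A p.2 a * X (p.1, a) (q.1, b) * B b q.2 := by
  rw [Finset.sum_comm]
  simp [mul_apply, Fintype.sum_prod_type, one_apply, Finset.sum_mul]

theorem opNorm_one_kronecker_le [DecidableEq l] (A : Matrix ι κ ℂ) :
    opNorm ((1 : Matrix l l ℂ) ⊗ₖ A) ≤ opNorm A := by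
  rw [one_kronecker]
  exact (opNorm_submatrix _ _ _).le.trans
    (opNorm_blockDiagonal_le (opNorm_nonneg A) fun _ => le_rfl)

/-- The matrices `L k` put side by side into one row `[L₁ L₂ ⋯]`. -/
def rowMat {K : Type} (L : K → Matrix ι κ ℂ) : Matrix ι (κ × K) ℂ :=
  of fun i r => L r.2 i r.1

variable {K : Type} [Fintype K]

theorem opNorm_sum_mul_mul_conjTranspose_le {X : K → Matrix κ κ ℂ} {c : ℝ} (hc : 0 ≤ c)
    (hX : ∀ k, opNorm (X k) ≤ c) (L : K → Matrix ι κ ℂ) :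
    opNorm (∑ k, L k * X k * (L k)ᴴ) ≤ opNorm (rowMat L) ^ 2 * c := by
  classical
  have factor : ∑ k, L k * X k * (L k)ᴴ = rowMat L * blockDiagonal X * (rowMat L)ᴴ := by
    ext i j
    simp [rowMat, mul_apply, Matrix.sum_apply, Fintype.sum_prod_type_right, blockDiagonal_apply]
  calc opNorm (∑ k, L k * X k * (L k)ᴴ)
      ≤ opNorm (rowMat L) * opNorm (blockDiagonal X) * opNorm (rowMat L)ᴴ :=
        factor ▸ opNorm_mul_mul_le _ _ _
    _ ≤ opNorm (rowMat L) * c * opNorm (rowMat L) := by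
        rw [opNorm_conjTranspose]
        have := opNorm_nonneg (rowMat L)
        gcongr
        exact opNorm_blockDiagonal_le hc hX
    _ = opNorm (rowMat L) ^ 2 * c := by ring

theorem opNorm_rowMat_one_kronecker_le [DecidableEq l] (L : K → Matrix ι κ ℂ) :
    opNorm (rowMat fun k => (1 : Matrix l l ℂ) ⊗ₖ L k) ≤ opNorm (rowMat L) := by
  have : (rowMat fun k => (1 : Matrix l l ℂ) ⊗ₖ L k) =
      ((1 : Matrix l l ℂ) ⊗ₖ rowMat L).submatrix (Equiv.refl _) (Equiv.prodAssoc l κ K) := by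
    ext i j
    simp [rowMat]
  rw [this, opNorm_submatrix]
  exact opNorm_one_kronecker_le _

end OperatorNorm

section Trace

open Matrix
open scoped Kronecker

variable {n ι ρ : Type} [Fintype n] [Fintype ι] [Fintype ρ]

/-- The matrix `(id ⊗ ⟨x, ·⟩)(D)` in `M_ρ ⊗ M_ι` for `x` in `M_ι[S_1^n]` and `D` in
`M_ρ ⊗ M_n`. -/
def slice {n ι ρ : Type} [Fintype n] (x : Matrix ι ι (n → n → ℂ))
    (D : Matrix (ρ × n) (ρ × n) ℂ) : Matrix (ρ × ι) (ρ × ι) ℂ :=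
  of fun p q => ∑ a, ∑ b, x p.2 q.2 a b * D (p.1, a) (q.1, b)

omit [Fintype ι] [Fintype ρ] in
theorem slice_smul (x : Matrix ι ι (n → n → ℂ)) (c : ℂ) (D : Matrix (ρ × n) (ρ × n) ℂ) :
    slice x (c • D) = c • slice x D := by
  ext p q
  simp [slice, Finset.mul_sum, mul_left_comm]

theorem exists_opNorm_slice_le (x : Matrix ι ι (n → n → ℂ)) :
    ∃ K : ℝ, ∀ (ρ : Type) [Fintype ρ] (D : Matrix (ρ × n) (ρ × n) ℂ),
      opNorm (slice x D) ≤ K * opNorm D := by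
  classical
  let L (r : ι) (a : n) : Matrix ι n ℂ := single r a 1
  let R (b : n) (s : ι) : Matrix n ι ℂ := single b s 1
  refine ⟨∑ c : ι × ι × n × n, ‖x c.1 c.2.1 c.2.2.1 c.2.2.2‖ *
    (opNorm (L c.1 c.2.2.1) * opNorm (R c.2.2.2 c.2.1)), fun ρ _ D => ?_⟩
  have entry (r s : ι) (a b : n) (p q : ρ × ι) :
      ((1 : Matrix ρ ρ ℂ) ⊗ₖ L r a * D * ((1 : Matrix ρ ρ ℂ) ⊗ₖ R b s)) p q =
        if q.2 = s then if p.2 = r then D (p.1, a) (q.1, b) else 0 else 0 := by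
    simp [L, R, mul_apply, Fintype.sum_prod_type, one_apply, single_apply, ite_and, eq_comm]
  have expand : slice x D = ∑ c : ι × ι × n × n, x c.1 c.2.1 c.2.2.1 c.2.2.2 •
      ((1 : Matrix ρ ρ ℂ) ⊗ₖ L c.1 c.2.2.1 * D * ((1 : Matrix ρ ρ ℂ) ⊗ₖ R c.2.2.2 c.2.1)) := by
    ext p q
    simp [slice, entry, Matrix.sum_apply, Fintype.sum_prod_type]
  rw [expand, Finset.sum_mul]
  refine (opNorm_sum_le _ _).trans (Finset.sum_le_sum fun c _ => ?_)
  rw [opNorm_smul, mul_assoc]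
  refine mul_le_mul_of_nonneg_left ?_ (norm_nonneg _)
  calc _ ≤ opNorm ((1 : Matrix ρ ρ ℂ) ⊗ₖ L c.1 c.2.2.1) * opNorm D *
          opNorm ((1 : Matrix ρ ρ ℂ) ⊗ₖ R c.2.2.2 c.2.1) := opNorm_mul_mul_le _ _ _
    _ ≤ opNorm (L c.1 c.2.2.1) * opNorm D * opNorm (R c.2.2.2 c.2.1) := by
        gcongr <;> solve_by_elim [opNorm_nonneg, opNorm_one_kronecker_le, mul_nonneg]
    _ = _ := by ring

theorem traceNorm_nonneg (x : Matrix ι ι (n → n → ℂ)) : 0 ≤ traceNorm n ι x := by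
  refine Real.sSup_nonneg ?_
  rintro r ⟨m, y, -, rfl⟩
  exact opNorm_nonneg _

theorem opNorm_slice_le_traceNorm (x : Matrix ι ι (n → n → ℂ)) {D : Matrix (ρ × n) (ρ × n) ℂ}
    (hD : opNorm D ≤ 1) : opNorm (slice x D) ≤ traceNorm n ι x := by
  obtain ⟨K, hK⟩ := exists_opNorm_slice_le x
  have hbdd : BddAbove {r : ℝ | ∃ (m : ℕ) (y : Matrix (Fin m) (Fin m) (n → n → ℂ)),
      minNorm n scalarNorm (Fin m) y ≤ 1 ∧
        r = minNorm ι scalarNorm (Fin m) (y.map (pairing x))} := by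
    refine ⟨max K 0, ?_⟩
    rintro r ⟨m, y, hy, rfl⟩
    calc _ ≤ K * minNorm n scalarNorm (Fin m) y := hK (Fin m) (of fun r s => y r.1 s.1 r.2 s.2)
      _ ≤ max K 0 * 1 := mul_le_mul (le_max_left _ _) hy (opNorm_nonneg _) (le_max_right _ _)
      _ = max K 0 := mul_one _
  let e := (Fintype.equivFin ρ).symm
  let D' := D.submatrix (e.prodCongr (Equiv.refl n)) (e.prodCongr (Equiv.refl n))
  have hD' : opNorm D' ≤ 1 := (opNorm_submatrix _ _ _).trans_le hD
  calc opNorm (slice x D)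
      = opNorm ((slice x D).submatrix (e.prodCongr (Equiv.refl ι)) (e.prodCongr (Equiv.refl ι))) :=
        (opNorm_submatrix _ _ _).symm
    _ ≤ traceNorm n ι x :=
        le_csSup hbdd ⟨_, of fun g h a b => D' (g, a) (h, b), hD', rfl⟩

theorem opNorm_slice_le (x : Matrix ι ι (n → n → ℂ)) (D : Matrix (ρ × n) (ρ × n) ℂ) :
    opNorm (slice x D) ≤ traceNorm n ι x * opNorm D := by
  rcases (opNorm_nonneg D).eq_or_lt with h0 | h0
  · obtain ⟨K, hK⟩ := exists_opNorm_slice_le x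
    simpa [← h0] using hK ρ D
  · have hnorm : ‖((opNorm D)⁻¹ : ℂ)‖ = (opNorm D)⁻¹ := by
      rw [norm_inv, Complex.norm_real, Real.norm_of_nonneg h0.le]
    have := opNorm_slice_le_traceNorm x (D := ((opNorm D)⁻¹ : ℂ) • D) (by
      rw [opNorm_smul, hnorm, inv_mul_cancel₀ h0.ne'])
    rwa [slice_smul, opNorm_smul, hnorm, inv_mul_le_iff₀ h0, mul_comm] at this

theorem traceNorm_submatrix_le {κ : Type} [Fintype κ] (x : Matrix ι ι (n → n → ℂ)) (e : κ ≃ ι) :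
    traceNorm n κ (x.submatrix e e) ≤ traceNorm n ι x := by
  refine Real.sSup_le ?_ (traceNorm_nonneg x)
  rintro r ⟨m, y, hy, rfl⟩
  let D : Matrix (Fin m × n) (Fin m × n) ℂ := of fun r s => y r.1 s.1 r.2 s.2
  let f := (Equiv.refl (Fin m)).prodCongr e
  exact (opNorm_submatrix (slice x D) f f).trans_le (opNorm_slice_le_traceNorm x hy)

/-- The element of `M_n[S_1^n] = CB(M_n, M_n)` that stands for the identity map. -/
def unitElement (n : Type) [DecidableEq n] : Matrix n n (n → n → ℂ) :=
  of fun i j => Pi.single i (Pi.single j 1)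

theorem traceNorm_unitElement_le (n : Type) [Fintype n] [DecidableEq n] :
    traceNorm n n (unitElement n) ≤ 1 := by
  refine Real.sSup_le ?_ zero_le_one
  rintro r ⟨m, y, hy, rfl⟩
  have : y.map (pairing (unitElement n)) = y := by
    ext g h a b
    simp [pairing, unitElement, Pi.single_apply, ite_apply]
  rwa [this]

end Trace

section OperatorSpaces

variable {V : Type u} [AddCommGroup V] [Module ℂ V] {W : Type v} [AddCommGroup W] [Module ℂ W]
  {ι κ ρ : Type}

/-- The matrix of `(id ⊗ u)(x)` in `M_ι ⊗ M_ρ`, for a map `u : V → M_ρ` and `x` in `M_ι[V]`. -/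
def ampl (u : V →ₗ[ℂ] (ρ → ρ → ℂ)) (x : Matrix ι ι V) : Matrix (ι × ρ) (ι × ρ) ℂ :=
  Matrix.of fun r s => u (x r.1 s.1) r.2 s.2

theorem ampl_apply (u : V →ₗ[ℂ] (ρ → ρ → ℂ)) (x : Matrix ι ι V) (r s : ι × ρ) :
    ampl u x r s = u (x r.1 s.1) r.2 s.2 := rfl

theorem ampl_add (u : V →ₗ[ℂ] (ρ → ρ → ℂ)) (x y : Matrix ι ι V) :
    ampl u (x + y) = ampl u x + ampl u y := by
  ext; simp [ampl_apply]

theorem ampl_smul (u : V →ₗ[ℂ] (ρ → ρ → ℂ)) (c : ℂ) (x : Matrix ι ι V) :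
    ampl u (c • x) = c • ampl u x := by
  ext; simp [ampl_apply]

variable [Fintype ι] [Fintype κ] [Fintype ρ] {N : MatNorm V}

/-- Complete contractions into a matrix algebra `M_ρ`. By Ruan's theorem they determine the norms
of an operator space, so contractivity is tested on them. -/
def IsMatrixContraction (N : MatNorm V) (u : V →ₗ[ℂ] (ρ → ρ → ℂ)) : Prop :=
  ∀ (ι : Type) [Fintype ι] (x : Matrix ι ι V), opNorm (ampl u x) ≤ N ι x

theorem IsMatrixContraction.comp {u : V →ₗ[ℂ] (ρ → ρ → ℂ)} (hu : IsMatrixContraction N u)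
    {N' : MatNorm W} {T : W →ₗ[ℂ] V} (hT : CompletelyContractive N' N T) :
    IsMatrixContraction N' (u ∘ₗ T) :=
  fun ι _ x => (hu ι (x.map T)).trans (hT ι x)

theorem nonneg_of_forall_isMatrixContraction
    (hN : ∀ {ι : Type} [Fintype ι] (x : Matrix ι ι V), 0 ≤ N ι x) {x : Matrix ι ι V} {C : ℝ}
    (h : ∀ (ρ : Type) [Fintype ρ] (u : V →ₗ[ℂ] (ρ → ρ → ℂ)),
      IsMatrixContraction N u → opNorm (ampl u x) ≤ C) : 0 ≤ C := by
  refine (opNorm_nonneg _).trans (h Unit 0 fun ι _ y => ?_)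
  have : ampl (0 : V →ₗ[ℂ] Unit → Unit → ℂ) y = (0 : ℂ) • 0 := by ext; simp [ampl_apply]
  rw [this, opNorm_smul, norm_zero, zero_mul]
  exact hN y

theorem opNorm_ampl_submatrix (u : V →ₗ[ℂ] (ρ → ρ → ℂ)) (x : Matrix ι ι V) (e : κ ≃ ι) :
    opNorm (ampl u (x.submatrix e e)) = opNorm (ampl u x) :=
  opNorm_submatrix (ampl u x) (e.prodCongr (.refl ρ)) (e.prodCongr (.refl ρ))

/-- The isomorphism `M_ρ → M_σ` that relabels rows and columns. -/
def relabel {σ : Type} (e : ρ ≃ σ) : (ρ → ρ → ℂ) →ₗ[ℂ] (σ → σ → ℂ) where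
  toFun y a b := y (e.symm a) (e.symm b)
  map_add' _ _ := rfl
  map_smul' _ _ := rfl

theorem opNorm_ampl_relabel {σ : Type} [Fintype σ] (e : ρ ≃ σ) (u : V →ₗ[ℂ] (ρ → ρ → ℂ))
    (x : Matrix ι ι V) : opNorm (ampl (relabel e ∘ₗ u) x) = opNorm (ampl u x) :=
  opNorm_submatrix (ampl u x) ((Equiv.refl ι).prodCongr e.symm) ((Equiv.refl ι).prodCongr e.symm)

end OperatorSpaces

section MatrixSeminorms

variable {V : Type u} [NormedAddCommGroup V]

theorem norm_apply_apply_le {ι κ : Type} [Fintype ι] [Fintype κ] (f : ι → κ → V) (i : ι) (j : κ) :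
    ‖f i j‖ ≤ ‖f‖ :=
  (norm_le_pi_norm (f i) j).trans (norm_le_pi_norm f i)

theorem norm_le_of_forall_apply {ι κ : Type} [Fintype ι] [Fintype κ] {f : ι → κ → V} {C : ℝ}
    (hC : 0 ≤ C) (h : ∀ i j, ‖f i j‖ ≤ C) : ‖f‖ ≤ C :=
  (pi_norm_le_iff_of_nonneg hC).2 fun i => (pi_norm_le_iff_of_nonneg hC).2 (h i)

variable [NormedSpace ℂ V]

/-- At each level the matrix norms are bounded by a multiple of the norm of `V`, applied
entrywise. -/
def IsDominated (N : MatNorm V) : Prop :=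
  ∀ (ι : Type) [Fintype ι], ∃ K : ℝ, 0 ≤ K ∧ ∀ f : ι → ι → V, N ι (Matrix.of f) ≤ K * ‖f‖

/-- Operator space structures on `V`, in the form of Ruan's theorem: the matrix norms are
determined by the complete contractions into matrix algebras. -/
structure IsOperatorSpace (N : MatNorm V) : Prop where
  nonneg : ∀ {ι : Type} [Fintype ι] (x : Matrix ι ι V), 0 ≤ N ι x
  le_of_forall : ∀ {ι : Type} [Fintype ι] (x : Matrix ι ι V) {C : ℝ},
    (∀ (ρ : Type) [Fintype ρ] (u : V →ₗ[ℂ] (ρ → ρ → ℂ)),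
      IsMatrixContraction N u → opNorm (ampl u x) ≤ C) → N ι x ≤ C
  isDominated : IsDominated N

/-- Matrix norms that are, at each level, dominated seminorms, and that are invariant under
relabelling. Unlike `IsOperatorSpace`, this passes to complex interpolation spaces without an appeal
to Ruan's theorem. -/
structure IsMatrixSeminorm (N : MatNorm V) : Prop where
  nonneg : ∀ {ι : Type} [Fintype ι] (x : Matrix ι ι V), 0 ≤ N ι x
  add_le : ∀ {ι : Type} [Fintype ι] (x y : Matrix ι ι V), N ι (x + y) ≤ N ι x + N ι y
  smul_le : ∀ {ι : Type} [Fintype ι] (c : ℂ) (x : Matrix ι ι V), N ι (c • x) ≤ ‖c‖ * N ι x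
  submatrix_le : ∀ {ι κ : Type} [Fintype ι] [Fintype κ] (e : κ ≃ ι) (x : Matrix ι ι V),
    N κ (x.submatrix e e) ≤ N ι x
  isDominated : IsDominated N

variable {N : MatNorm V}

theorem IsOperatorSpace.isMatrixSeminorm (hN : IsOperatorSpace N) : IsMatrixSeminorm N where
  nonneg := hN.nonneg
  add_le x y := hN.le_of_forall _ fun ρ _ u hu => by
    classical
    rw [ampl_add]
    exact (opNorm_add_le _ _).trans (add_le_add (hu _ x) (hu _ y))
  smul_le c x := hN.le_of_forall _ fun ρ _ u hu => by
    rw [ampl_smul, opNorm_smul]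
    exact mul_le_mul_of_nonneg_left (hu _ x) (norm_nonneg c)
  submatrix_le e x := hN.le_of_forall _ fun ρ _ u hu =>
    (opNorm_ampl_submatrix u x e).trans_le (hu _ x)
  isDominated := hN.isDominated

theorem isOperatorSpace_scalarNorm : IsOperatorSpace scalarNorm where
  nonneg _ := opNorm_nonneg _
  le_of_forall {ι} _ x C h := by
    let u : ℂ →ₗ[ℂ] (Unit → Unit → ℂ) := LinearMap.pi fun _ => LinearMap.pi fun _ => LinearMap.id
    have hampl (κ : Type) [Fintype κ] (y : Matrix κ κ ℂ) : opNorm (ampl u y) = opNorm y :=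
      opNorm_submatrix y (Equiv.prodPUnit κ) (Equiv.prodPUnit κ)
    exact (hampl ι x).symm.trans_le (h Unit u fun κ _ y => (hampl κ y).le)
  isDominated ι _ := by
    classical
    let L : (ι → ι → ℂ) →ₗ[ℂ] (EuclideanSpace ℂ ι →L[ℂ] EuclideanSpace ℂ ι) :=
      (Matrix.toEuclideanLin ≪≫ₗ LinearMap.toContinuousLinearMap).toLinearMap ∘ₗ
        (Matrix.ofLinearEquiv ℂ).toLinearMap
    refine ⟨_, ContinuousLinearMap.opNorm_nonneg L.toContinuousLinearMap, fun f => ?_⟩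
    rw [scalarNorm, opNorm_eq_norm, Matrix.l2_opNorm_def]
    exact L.toContinuousLinearMap.le_opNorm f

end MatrixSeminorms

section ConcreteOperatorSpaces

open scoped Matrix

variable {H : Type u} [NormedAddCommGroup H] [InnerProductSpace ℂ H] {ι ρ : Type} [Fintype ι]
  [Fintype ρ]

theorem inner_blockOp (x : Matrix ι ι (H →L[ℂ] H)) (v w : PiLp 2 fun _ : ι => H) :
    inner ℂ (blockOp x v) w = ∑ i, ∑ j, inner ℂ (x i j (v j)) (w i) := by
  simp [PiLp.inner_apply, blockOp, sum_inner]

/-- The compression `T ↦ (⟨b_g, T b_h⟩)_{gh}` of the operators in `E` to the span of a family `b`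
of vectors. -/
noncomputable def compression (E : Submodule ℂ (H →L[ℂ] H)) (b : ρ → H) :
    E →ₗ[ℂ] (ρ → ρ → ℂ) where
  toFun T g h := inner ℂ (b g) ((T : H →L[ℂ] H) (b h))
  map_add' S T := by ext; simp
  map_smul' c T := by ext; simp

/-- The operator `id ⊗ b : ℓ₂^ι ⊗ ℓ₂^ρ → ℓ₂^ι ⊗ H` for a family `b` of vectors, seen as the
operator `b : ℓ₂^ρ → H` that maps the unit vectors to them. -/
noncomputable def synthesis (b : ρ → H) (v : EuclideanSpace ℂ (ι × ρ)) : PiLp 2 fun _ : ι => H :=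
  WithLp.toLp 2 fun i => ∑ g, v (i, g) • b g

theorem norm_synthesis {b : ρ → H} (hb : Orthonormal ℂ b) (v : EuclideanSpace ℂ (ι × ρ)) :
    ‖synthesis b v‖ = ‖v‖ := by
  rw [← sq_eq_sq₀ (norm_nonneg _) (norm_nonneg _), PiLp.norm_sq_eq_of_L2,
    EuclideanSpace.norm_sq_eq, Fintype.sum_prod_type]
  refine Finset.sum_congr rfl fun i _ => ?_
  rw [synthesis, @norm_sq_eq_re_inner ℂ, hb.inner_sum]
  simp [Complex.sq_norm, Complex.normSq_apply]

theorem inner_ampl_compression (E : Submodule ℂ (H →L[ℂ] H)) (b : ρ → H) (x : Matrix ι ι E)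
    (v w : EuclideanSpace ℂ (ι × ρ)) :
    inner ℂ (WithLp.toLp 2 (ampl (compression E b) x *ᵥ v)) w =
      inner ℂ (blockOp (x.map fun T : E => (T : H →L[ℂ] H)) (synthesis b v)) (synthesis b w) := by
  rw [inner_blockOp]
  simp only [synthesis, map_sum, map_smul, sum_inner, inner_sum, inner_smul_left,
    inner_smul_right, Matrix.map_apply]
  simp only [PiLp.inner_apply, Matrix.mulVec, dotProduct, Fintype.sum_prod_type, ampl_apply,
    compression, LinearMap.coe_mk, AddHom.coe_mk, RCLike.inner_apply, map_sum,
    map_mul, inner_conj_symm, Finset.mul_sum]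
  refine Finset.sum_congr rfl fun i _ => ?_
  rw [Finset.sum_comm]
  refine Finset.sum_congr rfl fun j _ => Finset.sum_congr rfl fun g _ =>
    Finset.sum_congr rfl fun h _ => ?_
  ring

theorem subspaceNorm_nonneg (E : Submodule ℂ (H →L[ℂ] H)) {ι : Type} [Fintype ι]
    (x : Matrix ι ι E) : 0 ≤ subspaceNorm E ι x :=
  ContinuousLinearMap.opNorm_nonneg _

theorem isMatrixContraction_compression (E : Submodule ℂ (H →L[ℂ] H)) {b : ρ → H}
    (hb : Orthonormal ℂ b) : IsMatrixContraction (subspaceNorm E) (compression E b) := by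
  intro ι _ x
  refine ContinuousLinearMap.opNorm_le_of_re_inner_le (subspaceNorm_nonneg E x)
    fun v w hv hw => ?_
  calc _ = RCLike.re (inner ℂ (blockOp (x.map fun T : E => (T : H →L[ℂ] H)) (synthesis b v))
        (synthesis b w)) := congrArg _ (inner_ampl_compression E b x v w)
    _ ≤ ‖blockOp (x.map fun T : E => (T : H →L[ℂ] H)) (synthesis b v)‖ * ‖synthesis b w‖ :=
        re_inner_le_norm _ _
    _ ≤ subspaceNorm E ι x * ‖synthesis b v‖ * ‖synthesis b w‖ := by
        gcongr
        exact ContinuousLinearMap.le_opNorm _ _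
    _ = subspaceNorm E ι x := by
        rw [norm_synthesis hb, norm_synthesis hb, hv, hw, mul_one, mul_one]

omit [Fintype ι] in
theorem exists_orthonormal_synthesis_eq [Finite ι] (v w : PiLp 2 fun _ : ι => H) :
    ∃ (m : ℕ) (b : Fin m → H), Orthonormal ℂ b ∧
      v ∈ Set.range (synthesis b) ∧ w ∈ Set.range (synthesis b) := by
  let F : Submodule ℂ H := Submodule.span ℂ (Set.range v ∪ Set.range w)
  have : FiniteDimensional ℂ F :=
    FiniteDimensional.span_of_finite ℂ ((Set.finite_range v).union (Set.finite_range w))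
  let b := stdOrthonormalBasis ℂ F
  have mem_range (ξ : PiLp 2 fun _ : ι => H) (hξ : ∀ i, ξ i ∈ F) :
      ξ ∈ Set.range (synthesis (ι := ι) fun g => (b g : H)) := by
    refine ⟨WithLp.toLp 2 fun p => b.repr ⟨ξ p.1, hξ p.1⟩ p.2, PiLp.ext fun i => ?_⟩
    simpa [synthesis] using congrArg Subtype.val (b.sum_repr ⟨ξ i, hξ i⟩)
  exact ⟨_, fun g => b g, b.orthonormal.comp_linearIsometry F.subtypeₗᵢ,
    mem_range v fun i => Submodule.subset_span (.inl ⟨i, rfl⟩),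
    mem_range w fun i => Submodule.subset_span (.inr ⟨i, rfl⟩)⟩

theorem subspaceNorm_le_of_forall (E : Submodule ℂ (H →L[ℂ] H)) (x : Matrix ι ι E) {C : ℝ}
    (h : ∀ (ρ : Type) [Fintype ρ] (u : E →ₗ[ℂ] (ρ → ρ → ℂ)),
      IsMatrixContraction (subspaceNorm E) u → opNorm (ampl u x) ≤ C) :
    subspaceNorm E ι x ≤ C := by
  have hC : 0 ≤ C :=
    nonneg_of_forall_isMatrixContraction (subspaceNorm_nonneg E) h
  refine ContinuousLinearMap.opNorm_le_of_re_inner_le hC fun v w hv hw => ?_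
  obtain ⟨m, b, hb, ⟨v, rfl⟩, ⟨w, rfl⟩⟩ := exists_orthonormal_synthesis_eq v w
  rw [norm_synthesis hb] at hv hw
  calc _ = RCLike.re (inner ℂ (WithLp.toLp 2 (ampl (compression E b) x *ᵥ v)) w) :=
        congrArg _ (inner_ampl_compression E b x v w).symm
    _ ≤ ‖WithLp.toLp 2 (ampl (compression E b) x *ᵥ v)‖ * ‖w‖ := re_inner_le_norm _ _
    _ ≤ opNorm (ampl (compression E b) x) * ‖v‖ * ‖w‖ := by
        gcongr
        exact norm_toLp_mulVec_le _ v
    _ = opNorm (ampl (compression E b) x) := by rw [hv, hw, mul_one, mul_one]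
    _ ≤ C := h _ _ (isMatrixContraction_compression E hb)

theorem norm_blockOp_le (x : ι → ι → H →L[ℂ] H) :
    ‖blockOp (Matrix.of x)‖ ≤ Fintype.card ι ^ 2 * ‖x‖ := by
  refine ContinuousLinearMap.opNorm_le_of_re_inner_le (by positivity) fun v w hv hw => ?_
  rw [inner_blockOp]
  simp only [map_sum]
  have entry (i j : ι) : RCLike.re (inner ℂ (Matrix.of x i j (v j)) (w i)) ≤ ‖x‖ := calc
    _ ≤ ‖x i j (v j)‖ * ‖w i‖ := re_inner_le_norm _ _
    _ ≤ ‖x‖ * ‖v‖ * ‖w‖ := by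
        gcongr
        · exact (x i j).le_of_opNorm_le_of_le ((norm_le_pi_norm _ j).trans (norm_le_pi_norm x i))
            (PiLp.norm_apply_le v j)
        · exact PiLp.norm_apply_le w i
    _ = ‖x‖ := by rw [hv, hw, mul_one, mul_one]
  calc _ ≤ ∑ _i : ι, ∑ _j : ι, ‖x‖ :=
        Finset.sum_le_sum fun i _ => Finset.sum_le_sum fun j _ => entry i j
    _ = Fintype.card ι ^ 2 * ‖x‖ := by simp [sq, mul_assoc]

theorem isOperatorSpace_subspaceNorm (E : Submodule ℂ (H →L[ℂ] H)) :
    IsOperatorSpace (subspaceNorm E) where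
  nonneg := subspaceNorm_nonneg E
  le_of_forall x _ h := subspaceNorm_le_of_forall E x h
  isDominated ι _ := ⟨Fintype.card ι ^ 2, by positivity, fun f => (norm_blockOp_le _).trans (by
    gcongr
    exact norm_le_of_forall_apply (norm_nonneg f) (norm_apply_apply_le f))⟩

end ConcreteOperatorSpaces

section Sums

variable {κ : Type} {V : κ → Type u} {N : ∀ i, MatNorm (V i)} {ι : Type} [Fintype ι]

theorem completelyContractive_proj [Finite κ] [∀ i, AddCommGroup (V i)] [∀ i, Module ℂ (V i)]
    (i : κ) : CompletelyContractive (sumInftyNorm N) (N i) (LinearMap.proj i) :=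
  fun ι _ x => le_ciSup (f := fun i => N i ι (x.map fun v => v i)) (Set.finite_range _).bddAbove i

variable [Fintype κ]

theorem norm_component_le [∀ i, NormedAddCommGroup (V i)] (f : ι → ι → ∀ i, V i) (i : κ) :
    ‖fun r s => f r s i‖ ≤ ‖f‖ :=
  norm_le_of_forall_apply (norm_nonneg f) fun r s =>
    (norm_le_pi_norm (f r s) i).trans (norm_apply_apply_le f r s)

theorem isOperatorSpace_sumInftyNorm [∀ i, NormedAddCommGroup (V i)] [∀ i, NormedSpace ℂ (V i)]
    (hN : ∀ i, IsOperatorSpace (N i)) : IsOperatorSpace (sumInftyNorm N) where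
  nonneg _ := Real.iSup_nonneg fun i => (hN i).nonneg _
  le_of_forall x C h := by
    have hC : 0 ≤ C := nonneg_of_forall_isMatrixContraction
      (fun _ => Real.iSup_nonneg fun i => (hN i).nonneg _) h
    exact Real.iSup_le (fun i => (hN i).le_of_forall _ fun ρ _ u hu =>
      h ρ (u ∘ₗ LinearMap.proj i) (hu.comp (completelyContractive_proj i))) hC
  isDominated ι _ := by
    choose K hK0 hK using fun i => (hN i).isDominated ι
    refine ⟨∑ i, K i, Finset.sum_nonneg fun i _ => hK0 i, fun f => ?_⟩
    have hsum : 0 ≤ ∑ i, K i := Finset.sum_nonneg fun i _ => hK0 i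
    refine Real.iSup_le (fun i => ?_) (by positivity)
    calc N i ι (Matrix.of fun r s => f r s i) ≤ K i * ‖fun r s => f r s i‖ := hK i _
      _ ≤ (∑ i, K i) * ‖f‖ := by
        gcongr
        · exact Finset.single_le_sum (fun i _ => hK0 i) (Finset.mem_univ i)
        · exact norm_component_le f i

section Algebra

variable [∀ i, AddCommGroup (V i)] [∀ i, Module ℂ (V i)]

/-- The map `⊕ x_i ↦ ∑ φ_i(x_i)`, by which the norm of an `ℓ₁`-direct sum is tested. -/
noncomputable def sumMap {ρ : Type} (φ : ∀ i, V i →ₗ[ℂ] (ρ → ρ → ℂ)) :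
    (∀ i, V i) →ₗ[ℂ] (ρ → ρ → ℂ) where
  toFun v := ∑ i, φ i (v i)
  map_add' v w := by simp [Finset.sum_add_distrib]
  map_smul' c v := by simp [Finset.smul_sum]

omit [Fintype ι] in
theorem ampl_sumMap {ρ : Type} (φ : ∀ i, V i →ₗ[ℂ] (ρ → ρ → ℂ)) (x : Matrix ι ι (∀ i, V i)) :
    ampl (sumMap φ) x = ∑ i, ampl (φ i) (x.map fun v => v i) := by
  ext r s
  simp [ampl_apply, sumMap, Matrix.sum_apply]

theorem opNorm_ampl_sumMap_le_sum {ρ : Type} [Fintype ρ] {φ : ∀ i, V i →ₗ[ℂ] (ρ → ρ → ℂ)}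
    (hφ : ∀ i, IsMatrixContraction (N i) (φ i)) (x : Matrix ι ι (∀ i, V i)) :
    opNorm (ampl (sumMap φ) x) ≤ ∑ i, N i ι (x.map fun v => v i) := by
  rw [ampl_sumMap]
  exact (opNorm_sum_le _ _).trans (Finset.sum_le_sum fun i _ => hφ i ι _)

theorem isMatrixContraction_sumMap {ρ : Type} [Fintype ρ] {φ : ∀ i, V i →ₗ[ℂ] (ρ → ρ → ℂ)}
    (hφ : ∀ i, IsMatrixContraction (N i) (φ i)) :
    IsMatrixContraction (sumOneNorm N) (sumMap φ) := by
  intro ι _ x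
  have hbdd : BddAbove {c : ℝ | ∃ (m : ℕ) (φ : ∀ i, V i →ₗ[ℂ] (Fin m → Fin m → ℂ)),
      (∀ i, CompletelyContractive (N i) (minNorm (Fin m) scalarNorm) (φ i)) ∧
      c = minNorm (Fin m) scalarNorm ι (Matrix.of fun r s => ∑ i, φ i (x r s i))} := by
    refine ⟨∑ i, N i ι (x.map fun v => v i), ?_⟩
    rintro c ⟨m, χ, hχ, rfl⟩
    exact opNorm_ampl_sumMap_le_sum hχ x
  let e := Fintype.equivFin ρ
  have hrelabel : relabel e ∘ₗ sumMap φ = sumMap fun i => relabel e ∘ₗ φ i := by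
    ext v a b; simp [sumMap, relabel]
  rw [← opNorm_ampl_relabel e, hrelabel]
  exact le_csSup hbdd ⟨_, fun i => relabel e ∘ₗ φ i,
    fun i κ _ y => (opNorm_ampl_relabel e (φ i) y).trans_le (hφ i κ y), rfl⟩

theorem sumOneNorm_nonneg (x : Matrix ι ι (∀ i, V i)) : 0 ≤ sumOneNorm N ι x :=
  Real.sSup_nonneg (by rintro c ⟨m, φ, -, rfl⟩; exact opNorm_nonneg _)

theorem sumOneNorm_le {x : Matrix ι ι (∀ i, V i)} {C : ℝ} (hC : 0 ≤ C)
    (h : ∀ (ρ : Type) [Fintype ρ] (φ : ∀ i, V i →ₗ[ℂ] (ρ → ρ → ℂ)),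
      (∀ i, IsMatrixContraction (N i) (φ i)) → opNorm (ampl (sumMap φ) x) ≤ C) :
    sumOneNorm N ι x ≤ C := by
  refine Real.sSup_le ?_ hC
  rintro c ⟨m, φ, hφ, rfl⟩
  exact h (Fin m) φ hφ

end Algebra

variable [∀ i, NormedAddCommGroup (V i)] [∀ i, NormedSpace ℂ (V i)]

theorem isOperatorSpace_sumOneNorm (hN : ∀ i, IsDominated (N i)) :
    IsOperatorSpace (sumOneNorm N) where
  nonneg := sumOneNorm_nonneg
  le_of_forall x C h := by
    have hC : 0 ≤ C := nonneg_of_forall_isMatrixContraction sumOneNorm_nonneg h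
    exact sumOneNorm_le hC fun ρ _ φ hφ => h ρ _ (isMatrixContraction_sumMap hφ)
  isDominated ι _ := by
    choose K hK0 hK using fun i => hN i ι
    refine ⟨∑ i, K i, Finset.sum_nonneg fun i _ => hK0 i, fun f => ?_⟩
    have hsum : 0 ≤ ∑ i, K i := Finset.sum_nonneg fun i _ => hK0 i
    refine sumOneNorm_le (by positivity) fun ρ _ φ hφ =>
      (opNorm_ampl_sumMap_le_sum hφ _).trans ?_
    rw [Finset.sum_mul]
    refine Finset.sum_le_sum fun i _ => (hK i _).trans ?_
    gcongr
    · exact hK0 i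
    · exact norm_component_le f i

end Sums

section MinNorm

variable {D ρ : Type}

/-- The amplification `id ⊗ u : M_D[V] → M_D ⊗ M_ρ` of a map `u : V → M_ρ`, with values in
`M_{ρ × D}`. -/
def matMap (D : Type) {V : Type u} [AddCommGroup V] [Module ℂ V] (u : V →ₗ[ℂ] (ρ → ρ → ℂ)) :
    (D → D → V) →ₗ[ℂ] (ρ × D → ρ × D → ℂ) where
  toFun y p q := u (y p.2 q.2) p.1 q.1
  map_add' _ _ := by ext; simp
  map_smul' _ _ := by ext; simp

variable [Fintype D]

theorem opNorm_ampl_matMap [Fintype ρ] {ι : Type} [Fintype ι] {V : Type u} [AddCommGroup V]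
    [Module ℂ V] (u : V →ₗ[ℂ] (ρ → ρ → ℂ)) (x : Matrix ι ι (D → D → V)) :
    opNorm (ampl (matMap D u) x) =
      opNorm (ampl u (Matrix.of fun r s : ι × D => x r.1 s.1 r.2 s.2)) :=
  let e : ι × (ρ × D) ≃ (ι × D) × ρ :=
    (Equiv.prodCongrRight fun _ => Equiv.prodComm ρ D).trans (Equiv.prodAssoc ι D ρ).symm
  opNorm_submatrix (ampl u (Matrix.of fun r s : ι × D => x r.1 s.1 r.2 s.2)) e e

theorem IsMatrixContraction.matMap [Fintype ρ] {V : Type u} [AddCommGroup V] [Module ℂ V]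
    {N : MatNorm V} {u : V →ₗ[ℂ] (ρ → ρ → ℂ)} (hu : IsMatrixContraction N u) :
    IsMatrixContraction (minNorm D N) (matMap D u) :=
  fun _ _ x => (opNorm_ampl_matMap u x).trans_le (hu _ _)

variable {V : Type u} [NormedAddCommGroup V] {N : MatNorm V}

theorem norm_flatten_le {ι : Type} [Fintype ι] (f : ι → ι → D → D → V) :
    ‖fun r s : ι × D => f r.1 s.1 r.2 s.2‖ ≤ ‖f‖ :=
  norm_le_of_forall_apply (norm_nonneg f) fun r s =>
    (norm_apply_apply_le (f r.1 s.1) r.2 s.2).trans (norm_apply_apply_le f r.1 s.1)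

theorem IsDominated.minNorm (hN : IsDominated N) : IsDominated (minNorm D N) := fun ι _ => by
  obtain ⟨K, hK, h⟩ := hN (ι × D)
  exact ⟨K, hK, fun f => (h _).trans (mul_le_mul_of_nonneg_left (norm_flatten_le f) hK)⟩

theorem IsOperatorSpace.minNorm [NormedSpace ℂ V] (hN : IsOperatorSpace N) :
    IsOperatorSpace (minNorm D N) where
  nonneg _ := hN.nonneg _
  le_of_forall x _ h := hN.le_of_forall _ fun _ _ u hu =>
    (opNorm_ampl_matMap u x).symm.trans_le (h _ (OpSpace.matMap D u) hu.matMap)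
  isDominated := hN.isDominated.minNorm

end MinNorm

section Projective

open Matrix
open scoped Kronecker

section Representation

variable {V : Type u} [AddCommGroup V] [Module ℂ V] {n ι l μ : Type} [Fintype l] [Fintype μ]

/-- The element `α (x ⊗ y) β` of `M_ι[S_1^n ⊗ V]`, as in the definition of `projNorm`. -/
noncomputable def tensorSandwich (α : Matrix ι (l × μ) ℂ) (x : Matrix l l (n → n → ℂ))
    (y : Matrix μ μ V) (β : Matrix (l × μ) ι ℂ) : Matrix ι ι (n → n → V) :=
  of fun r s a b => ∑ P, ∑ Q, (α r P * x P.1 Q.1 a b * β Q s) • y P.2 Q.2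

theorem tensorSandwich_submatrix {l' μ' : Type} [Fintype l'] [Fintype μ'] (e : l' ≃ l)
    (f : μ' ≃ μ) (α : Matrix ι (l × μ) ℂ) (x : Matrix l l (n → n → ℂ)) (y : Matrix μ μ V)
    (β : Matrix (l × μ) ι ℂ) :
    tensorSandwich (α.submatrix (Equiv.refl ι) (e.prodCongr f)) (x.submatrix e e)
      (y.submatrix f f) (β.submatrix (e.prodCongr f) (Equiv.refl ι)) = tensorSandwich α x y β := by
  ext r s a b
  simp only [tensorSandwich, of_apply, submatrix_apply]
  exact Fintype.sum_equiv (e.prodCongr f) _ _ fun P =>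
    Fintype.sum_equiv (e.prodCongr f) _ _ fun Q => rfl

theorem tensorSandwich_one [DecidableEq l] [DecidableEq μ] (x : Matrix l l (n → n → ℂ))
    (y : Matrix μ μ V) (P Q : l × μ) :
    tensorSandwich 1 x y 1 P Q = fun a b => x P.1 Q.1 a b • y P.2 Q.2 := by
  ext a b
  simp [tensorSandwich, one_apply]

/-- The `n × n` block row isometry, up to the factor `√n`, by which every matrix is the
compression of `unitElement n ⊗ t`. -/
def spread (ι n : Type) [DecidableEq ι] [DecidableEq n] : Matrix ι (n × (ι × n)) ℂ :=
  of fun r P => if P.2 = (r, P.1) then 1 else 0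

variable [Fintype ι] [Fintype n]

theorem opNorm_spread_sq_le (ι n : Type) [Fintype ι] [Fintype n] [DecidableEq ι] [DecidableEq n] :
    opNorm (spread ι n) ^ 2 ≤ Fintype.card n := by
  have h : (spread ι n)ᴴᴴ * (spread ι n)ᴴ = (Fintype.card n : ℂ) • (1 : Matrix ι ι ℂ) := by
    ext r s
    simp [mul_apply, spread, Fintype.sum_prod_type, one_apply, eq_comm]
  simpa [opNorm_conjTranspose] using opNorm_sq_le_of_conjTranspose_mul_self h

theorem tensorSandwich_spread [DecidableEq ι] [DecidableEq n] (t : Matrix ι ι (n → n → V)) :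
    tensorSandwich (spread ι n) (unitElement n)
      (of fun r s : ι × n => t r.1 s.1 r.2 s.2) (spread ι n)ᴴ = t := by
  ext r s a b
  simp [tensorSandwich, spread, unitElement, Fintype.sum_prod_type, Pi.single_apply, ite_apply,
    ite_smul, apply_ite (starRingEnd ℂ)]

end Representation

section Norm

variable {V : Type u} [NormedAddCommGroup V] [NormedSpace ℂ V] {N : MatNorm V}
  {n ι : Type} [Fintype n] [Fintype ι]

theorem projNorm_eq (t : Matrix ι ι (n → n → V)) :
    projNorm n N ι t = sInf {c : ℝ | ∃ (l m : ℕ) (α : Matrix ι (Fin l × Fin m) ℂ)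
      (β : Matrix (Fin l × Fin m) ι ℂ) (x : Matrix (Fin l) (Fin l) (n → n → ℂ))
      (y : Matrix (Fin m) (Fin m) V), t = tensorSandwich α x y β ∧
      c = opNorm α * traceNorm n (Fin l) x * N (Fin m) y * opNorm β} := by
  simp only [projNorm, tensorSandwich, Fintype.sum_prod_type, ← Matrix.ext_iff, funext_iff,
    of_apply]

theorem projNorm_nonneg (hN : IsMatrixSeminorm N) (t : Matrix ι ι (n → n → V)) :
    0 ≤ projNorm n N ι t := by
  refine Real.sInf_nonneg ?_
  rintro c ⟨l, m, α, β, x, y, -, rfl⟩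
  have := hN.nonneg y
  have := traceNorm_nonneg x
  have := opNorm_nonneg α
  have := opNorm_nonneg β
  positivity

theorem projNorm_tensorSandwich_le (hN : IsMatrixSeminorm N) {l μ : Type} [Fintype l] [Fintype μ]
    (α : Matrix ι (l × μ) ℂ) (x : Matrix l l (n → n → ℂ)) (y : Matrix μ μ V)
    (β : Matrix (l × μ) ι ℂ) :
    projNorm n N ι (tensorSandwich α x y β) ≤
      opNorm α * traceNorm n l x * N μ y * opNorm β := by
  let e := (Fintype.equivFin l).symm
  let f := (Fintype.equivFin μ).symm
  let α' := α.submatrix (Equiv.refl ι) (e.prodCongr f)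
  let β' := β.submatrix (e.prodCongr f) (Equiv.refl ι)
  have hbdd : BddBelow {c : ℝ | ∃ (l' m : ℕ) (α' : Matrix ι (Fin l' × Fin m) ℂ)
      (β' : Matrix (Fin l' × Fin m) ι ℂ) (x' : Matrix (Fin l') (Fin l') (n → n → ℂ))
      (y' : Matrix (Fin m) (Fin m) V),
      tensorSandwich α x y β = tensorSandwich α' x' y' β' ∧
      c = opNorm α' * traceNorm n (Fin l') x' * N (Fin m) y' * opNorm β'} := by
    refine ⟨0, ?_⟩
    rintro c ⟨l', m, α', β', x', y', -, rfl⟩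
    have := hN.nonneg y'
    have := traceNorm_nonneg x'
    have := opNorm_nonneg α'
    have := opNorm_nonneg β'
    positivity
  calc projNorm n N ι (tensorSandwich α x y β)
      ≤ opNorm α' * traceNorm n _ (x.submatrix e e) * N _ (y.submatrix f f) * opNorm β' := by
        rw [projNorm_eq]
        exact csInf_le hbdd ⟨_, _, α', β', _, _, (tensorSandwich_submatrix e f α x y β).symm, rfl⟩
    _ ≤ opNorm α * traceNorm n l x * N μ y * opNorm β := by
        rw [opNorm_submatrix, opNorm_submatrix]
        have := opNorm_nonneg α
        have := opNorm_nonneg β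
        have := traceNorm_nonneg x
        have := hN.nonneg (y.submatrix f f)
        gcongr
        · exact traceNorm_submatrix_le x e
        · exact hN.submatrix_le f y

theorem projNorm_le_card_mul_minNorm (hN : IsMatrixSeminorm N) (t : Matrix ι ι (n → n → V)) :
    projNorm n N ι t ≤ Fintype.card n * minNorm n N ι t := by
  classical
  have hmin : 0 ≤ minNorm n N ι t := hN.nonneg _
  calc projNorm n N ι t
      = projNorm n N ι (tensorSandwich (spread ι n) (unitElement n)
          (of fun r s : ι × n => t r.1 s.1 r.2 s.2) (spread ι n)ᴴ) := by
        rw [tensorSandwich_spread]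
    _ ≤ opNorm (spread ι n) * traceNorm n n (unitElement n) * minNorm n N ι t *
          opNorm (spread ι n)ᴴ := projNorm_tensorSandwich_le hN _ _ _ _
    _ ≤ opNorm (spread ι n) * 1 * minNorm n N ι t * opNorm (spread ι n) := by
        rw [opNorm_conjTranspose]
        gcongr <;> first | exact opNorm_nonneg _ | exact traceNorm_unitElement_le n
    _ = opNorm (spread ι n) ^ 2 * minNorm n N ι t := by ring
    _ ≤ Fintype.card n * minNorm n N ι t :=
        mul_le_mul_of_nonneg_right (opNorm_spread_sq_le ι n) hmin

omit [Fintype ι] in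
theorem IsDominated.projNorm (hN : IsMatrixSeminorm N) : IsDominated (projNorm n N) :=
  fun ι _ => by
    obtain ⟨K, hK, h⟩ := hN.isDominated.minNorm (D := n) ι
    refine ⟨Fintype.card n * K, by positivity, fun f => ?_⟩
    rw [mul_assoc]
    exact (projNorm_le_card_mul_minNorm hN _).trans (by gcongr; exact h f)

theorem le_projNorm {t : Matrix ι ι (n → n → V)} {C : ℝ}
    (h : ∀ (l m : ℕ) (α : Matrix ι (Fin l × Fin m) ℂ) (β : Matrix (Fin l × Fin m) ι ℂ)
      (x : Matrix (Fin l) (Fin l) (n → n → ℂ)) (y : Matrix (Fin m) (Fin m) V),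
      t = tensorSandwich α x y β →
      C ≤ opNorm α * traceNorm n (Fin l) x * N (Fin m) y * opNorm β) :
    C ≤ projNorm n N ι t := by
  classical
  rw [projNorm_eq]
  refine le_csInf ⟨_, _, _, _, _, _, _, ((tensorSandwich_submatrix (Fintype.equivFin n).symm
    (Fintype.equivFin (ι × n)).symm _ _ _ _).trans (tensorSandwich_spread t)).symm, rfl⟩ ?_
  rintro c ⟨l, m, α, β, x, y, ht, rfl⟩
  exact h l m α β x y ht

end Norm

section Choi

variable {V : Type u} [NormedAddCommGroup V] [NormedSpace ℂ V] {N : MatNorm V}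
  {n ρ : Type} [DecidableEq n]

/-- The map `V → M_ρ ⊗ M_n` that corresponds to `Φ : M_n ⊗ V → M_ρ`, by the duality between
`S_1^n` and `M_n`: the value at `v` is the Choi matrix of `C ↦ Φ (C ⊗ v)`. -/
def choi (Φ : (n → n → V) →ₗ[ℂ] (ρ → ρ → ℂ)) : V →ₗ[ℂ] (ρ × n → ρ × n → ℂ) where
  toFun v p q := Φ (Pi.single p.2 (Pi.single q.2 v)) p.1 q.1
  map_add' v w := by ext; simp [Pi.single_add]
  map_smul' c v := by ext; simp [Pi.single_smul]

variable [Fintype n]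

theorem apply_apply_eq_sum_choi (Φ : (n → n → V) →ₗ[ℂ] (ρ → ρ → ℂ)) (v : n → n → V) (p q : ρ) :
    Φ v p q = ∑ a, ∑ b, choi Φ (v a b) (p, a) (q, b) := by
  have hv : v = ∑ a, ∑ b, Pi.single a (Pi.single b (v a b)) := by
    ext a b
    simp [Finset.sum_apply, Pi.single_apply, ite_apply]
  conv_lhs => rw [hv]
  simp [choi, Finset.sum_apply]

variable [Fintype ρ]

theorem ampl_tensorSandwich [DecidableEq ρ] {ι l μ : Type} [Fintype l] [Fintype μ]
    (Φ : (n → n → V) →ₗ[ℂ] (ρ → ρ → ℂ)) (α : Matrix ι (l × μ) ℂ) (x : Matrix l l (n → n → ℂ))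
    (y : Matrix μ μ V) (β : Matrix (l × μ) ι ℂ) :
    ampl Φ (tensorSandwich α x y β) = ((1 : Matrix ρ ρ ℂ) ⊗ₖ α *
      (of fun r s : ρ × (l × μ) => ∑ a, ∑ b, x r.2.1 s.2.1 a b *
        choi Φ (y r.2.2 s.2.2) (r.1, a) (s.1, b)) *
      (1 : Matrix ρ ρ ℂ) ⊗ₖ β).submatrix Prod.swap Prod.swap := by
  ext ⟨r, p⟩ ⟨s, q⟩
  have expand : tensorSandwich α x y β r s =
      ∑ P, ∑ Q, (α r P * β Q s) • fun a b => x P.1 Q.1 a b • y P.2 Q.2 := by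
    ext a b
    simp [tensorSandwich, smul_smul, Finset.sum_apply, mul_right_comm]
  have elementary (v : V) (c : n → n → ℂ) : Φ (fun a b => c a b • v) p q =
      ∑ a, ∑ b, c a b * choi Φ v (p, a) (q, b) := by
    simp [apply_apply_eq_sum_choi Φ fun a b => c a b • v]
  simp only [submatrix_apply, Prod.swap_prod_mk, one_kronecker_mul_mul_apply, ampl_apply, expand,
    map_sum, map_smul, Finset.sum_apply, Pi.smul_apply, smul_eq_mul, elementary, of_apply,
    mul_right_comm]

theorem isMatrixContraction_projNorm {Φ : (n → n → V) →ₗ[ℂ] (ρ → ρ → ℂ)}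
    (h : IsMatrixContraction N (choi Φ)) : IsMatrixContraction (projNorm n N) Φ := by
  classical
  intro ι _ t
  refine le_projNorm fun l m α β x y ht => ?_
  let D : Matrix ((Fin m × ρ) × n) ((Fin m × ρ) × n) ℂ :=
    (ampl (choi Φ) y).submatrix (Equiv.prodAssoc _ _ _) (Equiv.prodAssoc _ _ _)
  let e : ρ × (Fin l × Fin m) ≃ (Fin m × ρ) × Fin l :=
    ((Equiv.prodCongrRight fun _ => Equiv.prodComm _ _).trans (Equiv.prodAssoc _ _ _).symm).trans
      ((Equiv.prodComm _ _).prodCongr (Equiv.refl _))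
  have key : ampl Φ t = ((1 : Matrix ρ ρ ℂ) ⊗ₖ α * (slice x D).submatrix e e *
      (1 : Matrix ρ ρ ℂ) ⊗ₖ β).submatrix (Equiv.prodComm ι ρ) (Equiv.prodComm ι ρ) := by
    rw [ht]
    exact ampl_tensorSandwich Φ α x y β
  have slice_le : opNorm (slice x D) ≤ traceNorm n (Fin l) x * N (Fin m) y := by
    refine (opNorm_slice_le x D).trans ?_
    rw [opNorm_submatrix]
    exact mul_le_mul_of_nonneg_left (h _ y) (traceNorm_nonneg x)
  calc opNorm (ampl Φ t)
      ≤ opNorm ((1 : Matrix ρ ρ ℂ) ⊗ₖ α) * opNorm (slice x D) *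
          opNorm ((1 : Matrix ρ ρ ℂ) ⊗ₖ β) := by
        rw [key, opNorm_submatrix, ← opNorm_submatrix (slice x D) e e]
        exact opNorm_mul_mul_le _ _ _
    _ ≤ opNorm α * (traceNorm n (Fin l) x * N (Fin m) y) * opNorm β := by
        have bound_nonneg := (opNorm_nonneg (slice x D)).trans slice_le
        exact mul_le_mul
          (mul_le_mul (opNorm_one_kronecker_le α) slice_le (opNorm_nonneg _) (opNorm_nonneg _))
          (opNorm_one_kronecker_le β) (opNorm_nonneg _) (mul_nonneg (opNorm_nonneg _) bound_nonneg)
    _ = _ := by ring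

theorem IsMatrixContraction.choi (hN : IsMatrixSeminorm N)
    {Φ : (n → n → V) →ₗ[ℂ] (ρ → ρ → ℂ)} (h : IsMatrixContraction (projNorm n N) Φ) :
    IsMatrixContraction N (choi Φ) := by
  classical
  intro ι _ y
  let t := tensorSandwich (1 : Matrix (n × ι) (n × ι) ℂ) (unitElement n) y 1
  let e : ι × (ρ × n) ≃ (n × ι) × ρ :=
    (((Equiv.prodAssoc _ _ _).symm).trans (Equiv.prodComm _ _)).trans (Equiv.prodAssoc _ _ _).symm
  have key : ampl (OpSpace.choi Φ) y = (ampl Φ t).submatrix e e := by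
    have ht (a b : n) (r s : ι) : t (a, r) (b, s) = Pi.single a (Pi.single b (y r s)) := by
      ext a' b'
      simp [t, tensorSandwich_one, unitElement, Pi.single_apply, ite_apply]
    ext ⟨r, p, a⟩ ⟨s, q, b⟩
    exact (congr_fun₂ (congr_arg Φ (ht a b r s)) p q).symm
  calc opNorm (ampl (OpSpace.choi Φ) y) = opNorm (ampl Φ t) := by rw [key, opNorm_submatrix]
    _ ≤ projNorm n N (n × ι) t := h _ t
    _ ≤ opNorm (1 : Matrix (n × ι) (n × ι) ℂ) * traceNorm n n (unitElement n) * N ι y *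
          opNorm (1 : Matrix (n × ι) (n × ι) ℂ) := projNorm_tensorSandwich_le hN _ _ _ _
    _ ≤ 1 * 1 * N ι y * 1 := by
        have h1 : opNorm (1 : Matrix (n × ι) (n × ι) ℂ) ≤ 1 :=
          opNorm_le_one_of_conjTranspose_mul_self (by simp)
        have := hN.nonneg y
        gcongr
        · exact opNorm_nonneg _
        · exact traceNorm_nonneg _
        · exact traceNorm_unitElement_le n
    _ = N ι y := by ring

end Choi

end Projective

section Conjugation

open Matrix
open scoped Kronecker

variable {V : Type u} [AddCommGroup V] [Module ℂ V] {W : Type v} [AddCommGroup W] [Module ℂ W]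
  {m n l ρ K : Type} [Fintype n]

/-- The map `x ↦ A x Aᴴ` on matrices over a vector space. -/
def conjBy (A : Matrix m n ℂ) : (n → n → V) →ₗ[ℂ] (m → m → V) where
  toFun x i j := ∑ a, ∑ b, (A i a * star (A j b)) • x a b
  map_add' x y := by ext i j; simp [Finset.sum_add_distrib]
  map_smul' c x := by ext i j; simp [Finset.smul_sum, smul_comm c]

theorem map_conjBy_apply (L : V →ₗ[ℂ] W) (A : Matrix m n ℂ) (x : n → n → V) (i j : m) :
    L (conjBy A x i j) = conjBy A (fun a b => L (x a b)) i j := by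
  simp [conjBy]

theorem conjBy_one [DecidableEq n] (x : n → n → V) : conjBy 1 x = x := by
  ext i j
  simp [conjBy, one_apply]

theorem conjBy_single [DecidableEq n] (A : Matrix m n ℂ) (a b : n) (v : V) (i j : m) :
    conjBy A (Pi.single a (Pi.single b v)) i j = (A i a * star (A j b)) • v := by
  simp [conjBy, Pi.single_apply, ite_apply]

theorem conjBy_conjBy [Fintype m] (B : Matrix l m ℂ) (A : Matrix m n ℂ) (x : n → n → V) :
    conjBy B (conjBy A x) = conjBy (B * A) x := by
  classical
  suffices h : conjBy B ∘ₗ conjBy A = conjBy (V := V) (B * A) from LinearMap.congr_fun h x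
  ext a b v i j
  change conjBy B (conjBy A (Pi.single a (Pi.single b v))) i j =
    conjBy (B * A) (Pi.single a (Pi.single b v)) i j
  have h : conjBy A (Pi.single a (Pi.single b v)) = fun c d => (A c a * star (A d b)) • v := by
    ext c d
    rw [conjBy_single]
  rw [conjBy_single, h]
  simp [conjBy, mul_apply, Finset.sum_mul_sum, Finset.sum_smul, smul_smul, mul_mul_mul_comm]

theorem matMap_comp_conjBy [Fintype ρ] [DecidableEq ρ] (u : V →ₗ[ℂ] (ρ → ρ → ℂ))
    (A : Matrix m n ℂ) :
    matMap m u ∘ₗ conjBy A = conjBy ((1 : Matrix ρ ρ ℂ) ⊗ₖ A) ∘ₗ matMap n u := by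
  ext x p q
  simp [matMap, conjBy, Fintype.sum_prod_type, one_apply, Finset.sum_apply, apply_ite star]

theorem choi_comp_conjBy [Fintype m] [DecidableEq m] [DecidableEq n] [Fintype ρ] [DecidableEq ρ]
    {V : Type u} [NormedAddCommGroup V] [NormedSpace ℂ V]
    (Φ : (m → m → V) →ₗ[ℂ] (ρ → ρ → ℂ)) (A : Matrix m n ℂ) :
    choi (Φ ∘ₗ conjBy A) = conjBy ((1 : Matrix ρ ρ ℂ) ⊗ₖ Aᵀ) ∘ₗ choi Φ := by
  ext v p q
  have h := apply_apply_eq_sum_choi Φ (conjBy A (Pi.single p.2 (Pi.single q.2 v))) p.1 q.1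
  simp only [conjBy_single] at h
  simpa [choi, conjBy, Fintype.sum_prod_type, one_apply, apply_ite star] using h

/-- The linear map `C^ρ → C^ρ ⊗ C^m ⊗ C^n`, `ξ ↦ ξ ⊗ vec A`. -/
def vecColumn (ρ : Type) [DecidableEq ρ] (A : Matrix m n ℂ) : Matrix ((ρ × m) × n) ρ ℂ :=
  of fun p r => if p.1.1 = r then A p.1.2 p.2 else 0

theorem choi_matMap_comp_conjBy [Fintype ρ] [DecidableEq ρ] [DecidableEq n]
    {V : Type u} [NormedAddCommGroup V] [NormedSpace ℂ V]
    (u : V →ₗ[ℂ] (ρ → ρ → ℂ)) (A : Matrix m n ℂ) :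
    choi (matMap m u ∘ₗ conjBy A) = conjBy (vecColumn ρ A) ∘ₗ u := by
  ext v p q
  change u (conjBy A (Pi.single p.2 (Pi.single q.2 v)) p.1.2 q.1.2) p.1.1 q.1.1 = _
  rw [conjBy_single]
  simp [conjBy, vecColumn, apply_ite star]

section Contractions

variable {N : MatNorm V}

theorem ampl_conjBy_comp {ι : Type} [Fintype ι] [DecidableEq ι] (A : Matrix m n ℂ)
    (u : V →ₗ[ℂ] (n → n → ℂ)) (x : Matrix ι ι V) :
    ampl (conjBy A ∘ₗ u) x = (1 : Matrix ι ι ℂ) ⊗ₖ A * ampl u x * ((1 : Matrix ι ι ℂ) ⊗ₖ A)ᴴ := by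
  ext p q
  rw [conjTranspose_kronecker, conjTranspose_one, one_kronecker_mul_mul_apply]
  simp [ampl_apply, conjBy, mul_right_comm]

theorem isMatrixContraction_smul_sum_conjBy [Fintype m] [Fintype K]
    (hN : ∀ {ι : Type} [Fintype ι] (x : Matrix ι ι V), 0 ≤ N ι x) {L : K → Matrix m n ℂ}
    {u : K → V →ₗ[ℂ] (n → n → ℂ)} (hu : ∀ k, IsMatrixContraction N (u k)) {c : ℂ}
    (hc : ‖c‖ * opNorm (rowMat L) ^ 2 ≤ 1) :
    IsMatrixContraction N (c • ∑ k, conjBy (L k) ∘ₗ u k) := by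
  classical
  intro ι _ x
  have expand : ampl (c • ∑ k, conjBy (L k) ∘ₗ u k) x =
      c • ∑ k, (1 : Matrix ι ι ℂ) ⊗ₖ L k * ampl (u k) x * ((1 : Matrix ι ι ℂ) ⊗ₖ L k)ᴴ := by
    simp only [← ampl_conjBy_comp]
    ext p q
    simp [ampl_apply, Matrix.sum_apply]
  calc opNorm (ampl (c • ∑ k, conjBy (L k) ∘ₗ u k) x)
      ≤ ‖c‖ * (opNorm (rowMat fun k => (1 : Matrix ι ι ℂ) ⊗ₖ L k) ^ 2 * N ι x) := by
        rw [expand, opNorm_smul]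
        gcongr
        exact opNorm_sum_mul_mul_conjTranspose_le (hN x) (fun k => hu k ι x) _
    _ ≤ ‖c‖ * (opNorm (rowMat L) ^ 2 * N ι x) := by
        have := hN x
        gcongr
        · exact opNorm_nonneg _
        · exact opNorm_rowMat_one_kronecker_le L
    _ ≤ 1 * N ι x := by
        rw [← mul_assoc]
        exact mul_le_mul_of_nonneg_right hc (hN x)
    _ = N ι x := one_mul _

end Contractions

end Conjugation

section KrausMaps

open Matrix
open scoped Kronecker

section SingleBlock

variable {m n ρ K : Type} [Fintype m] [Fintype n] [Fintype K] [DecidableEq K]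

theorem opNorm_rowMat_le_one [DecidableEq n] {B : K → Matrix m n ℂ}
    (hB : ∀ k k', (B k)ᴴ * B k' = if k = k' then 1 else 0) : opNorm (rowMat B) ≤ 1 := by
  refine opNorm_le_one_of_conjTranspose_mul_self ?_
  ext ⟨b, k⟩ ⟨b', k'⟩
  have h : ((rowMat B)ᴴ * rowMat B) (b, k) (b', k') = ((B k)ᴴ * B k') b b' := by
    simp [rowMat, mul_apply]
  rw [h, hB]
  split_ifs with hk <;> simp [one_apply, hk]

theorem opNorm_rowMat_vecColumn_sq_le [Fintype ρ] [DecidableEq ρ] {B : K → Matrix m n ℂ} {w : ℂ}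
    (hB : ∀ k k', ((B k)ᴴ * B k').trace = if k = k' then w else 0) :
    opNorm (rowMat fun k => vecColumn ρ (B k)) ^ 2 ≤ ‖w‖ := by
  refine opNorm_sq_le_of_conjTranspose_mul_self ?_
  ext ⟨r, k⟩ ⟨r', k'⟩
  have h : ((rowMat fun k => vecColumn ρ (B k))ᴴ * rowMat fun k => vecColumn ρ (B k))
      (r, k) (r', k') = if r = r' then ((B k)ᴴ * B k').trace else 0 := by
    have trace_eq : ((B k)ᴴ * B k').trace = ∑ a, ∑ b, star (B k a b) * B k' a b := by
      rw [Finset.sum_comm]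
      simp [trace, mul_apply]
    rw [trace_eq]
    simp [rowMat, vecColumn, mul_apply, Fintype.sum_prod_type, apply_ite star,
      Finset.sum_ite_irrel, eq_comm]
  rw [h, hB]
  split_ifs with hr hk <;> simp [one_apply, *]

variable {V : Type u} [NormedAddCommGroup V] [NormedSpace ℂ V] {N : MatNorm V} [Fintype ρ]

theorem isMatrixContraction_projNorm_smul_sum
    (hN : ∀ {ι : Type} [Fintype ι] (x : Matrix ι ι V), 0 ≤ N ι x) {B : K → Matrix m n ℂ}
    {u : K → V →ₗ[ℂ] (ρ → ρ → ℂ)} (hu : ∀ k, IsMatrixContraction N (u k)) {c w : ℂ}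
    (hB : ∀ k k', ((B k)ᴴ * B k').trace = if k = k' then w else 0) (hc : ‖c‖ * ‖w‖ ≤ 1) :
    IsMatrixContraction (projNorm n N) (c • ∑ k, matMap m (u k) ∘ₗ conjBy (B k)) := by
  classical
  have hchoi : choi (c • ∑ k, matMap m (u k) ∘ₗ conjBy (B k)) =
      c • ∑ k, conjBy (vecColumn ρ (B k)) ∘ₗ u k := by
    simp only [← choi_matMap_comp_conjBy]
    ext v p q
    simp [choi]
  refine isMatrixContraction_projNorm ?_
  rw [hchoi]
  refine isMatrixContraction_smul_sum_conjBy hN hu (le_trans ?_ hc)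
  gcongr
  exact opNorm_rowMat_vecColumn_sq_le hB

/-- The completely positive map `x ↦ ∑_k B_k x B_kᴴ`. -/
noncomputable def krausMap {V : Type u} [AddCommGroup V] [Module ℂ V] (B : K → Matrix m n ℂ) :
    (n → n → V) →ₗ[ℂ] (m → m → V) :=
  ∑ k, conjBy (B k)

theorem completelyContractive_minNorm (hN : IsOperatorSpace N) {W : Type v} [AddCommGroup W]
    [Module ℂ W] {N' : MatNorm W} {F : W →ₗ[ℂ] (m → m → V)}
    (h : ∀ (ρ : Type) [Fintype ρ] (u : V →ₗ[ℂ] (ρ → ρ → ℂ)),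
      IsMatrixContraction N u → IsMatrixContraction N' (matMap m u ∘ₗ F)) :
    CompletelyContractive N' (minNorm m N) F :=
  fun ι _ x => hN.le_of_forall _ fun ρ _ u hu =>
    (opNorm_ampl_matMap u (x.map F)).symm.trans_le (h ρ u hu ι x)

theorem completelyContractive_smul_krausMap [DecidableEq n] (hN : IsOperatorSpace N)
    {B : K → Matrix m n ℂ} (hB : ∀ k k', (B k)ᴴ * B k' = if k = k' then 1 else 0) {c : ℂ}
    (hc : ‖c‖ ≤ 1) : CompletelyContractive (minNorm n N) (minNorm m N) (c • krausMap B) := by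
  refine completelyContractive_minNorm hN fun ρ _ u hu => ?_
  classical
  have key : matMap m u ∘ₗ (c • krausMap B) =
      c • ∑ k, conjBy ((1 : Matrix ρ ρ ℂ) ⊗ₖ B k) ∘ₗ matMap n u := by
    simp only [← matMap_comp_conjBy]
    exact LinearMap.ext fun x => by simp [krausMap]
  rw [key]
  refine isMatrixContraction_smul_sum_conjBy (fun _ => hN.nonneg _) (fun _ => hu.matMap) ?_
  have hrow := (opNorm_rowMat_one_kronecker_le (l := ρ) B).trans
    (opNorm_rowMat_le_one hB)
  exact mul_le_one₀ hc (sq_nonneg _) (pow_le_one₀ (opNorm_nonneg _) hrow)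

end SingleBlock

end KrausMaps

section KrausSums

open Matrix
open scoped Kronecker

section Basis

variable {n D S K : Type} [Fintype n] [Fintype D] [DecidableEq n] [DecidableEq S] [DecidableEq K]

/-- A trace-orthogonal family of isometries `A_{s,k} : ℂⁿ → ℂ^D`. For each `s` the ranges of
the `A_{s,k}` are pairwise orthogonal, so that `x ↦ ∑_k A_{s,k} x A_{s,k}ᴴ` is a `*`-homomorphism,
and the whole family is orthogonal for the trace. -/
structure IsKrausBasis (A : S → K → Matrix D n ℂ) : Prop where
  isometry : ∀ s k k', (A s k)ᴴ * A s k' = if k = k' then 1 else 0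
  trace_eq : ∀ x y : S × K,
    ((A x.1 x.2)ᴴ * A y.1 y.2).trace = if x = y then (Fintype.card n : ℂ) else 0

variable {A : S → K → Matrix D n ℂ}

theorem IsKrausBasis.isometry_conj (hA : IsKrausBasis A) (s : S) (k k' : K) :
    ((A s k)ᴴᵀ)ᴴ * (A s k')ᴴᵀ = if k = k' then 1 else 0 := by
  have h : ((A s k)ᴴᵀ)ᴴ = (A s k)ᵀ := by ext; simp
  rw [h, ← transpose_mul, hA.isometry, apply_ite transpose, transpose_one, transpose_zero]
  simp only [eq_comm]

theorem IsKrausBasis.trace_conjTranspose (hA : IsKrausBasis A) (x y : S × K) :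
    (((A x.1 x.2)ᴴ)ᴴ * (A y.1 y.2)ᴴ).trace = if x = y then (Fintype.card n : ℂ) else 0 := by
  rw [conjTranspose_conjTranspose, trace_mul_comm, hA.trace_eq]
  simp only [eq_comm]

end Basis

variable {κ D T : Type} {n S K : κ → Type} [∀ i, Fintype (n i)] [∀ i, Fintype (K i)]

section Definitions

variable {V : Type u} [AddCommGroup V] [Module ℂ V]

/-- The diagonal map with entries `c_i`. -/
def scale {V : κ → Type u} [∀ i, AddCommGroup (V i)] [∀ i, Module ℂ (V i)] (c : κ → ℂ) :
    (∀ i, V i) →ₗ[ℂ] (∀ i, V i) :=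
  LinearMap.pi fun i => c i • LinearMap.proj i

/-- The component `M_D(ℓ^T[V]) → M_D[V]` at `t`. -/
def component (D : Type) (t : T) : (D → D → T → V) →ₗ[ℂ] (D → D → V) :=
  ((LinearMap.proj t).compLeft D).compLeft D

/-- The unnormalized embedding `⊕_i M_{n_i}[V] → M_D(ℓ^T[V])`, whose component at `t = e (i, s)` is
`x ↦ ∑_k A_{i,s,k} x_i A_{i,s,k}ᴴ`. -/
noncomputable def krausIn (A : ∀ i, S i → K i → Matrix D (n i) ℂ) (e : (Σ i, S i) ≃ T) :
    (∀ i, n i → n i → V) →ₗ[ℂ] (D → D → T → V) where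
  toFun x p q t := krausMap (A (e.symm t).1 (e.symm t).2) (x (e.symm t).1) p q
  map_add' _ _ := by ext; simp
  map_smul' _ _ := by ext; simp

/-- The adjoint of `krausIn`, that is, `y ↦ ⊕_i ∑_{s,k} A_{i,s,k}ᴴ y_{e (i, s)} A_{i,s,k}`. -/
noncomputable def krausOut [Fintype D] [∀ i, Fintype (S i)]
    (A : ∀ i, S i → K i → Matrix D (n i) ℂ) (e : (Σ i, S i) ≃ T) :
    (D → D → T → V) →ₗ[ℂ] (∀ i, n i → n i → V) :=
  LinearMap.pi fun i => ∑ s, krausMap (fun k => (A i s k)ᴴ) ∘ₗ component D (e ⟨i, s⟩)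

theorem component_single [DecidableEq D] (a b : D) (v : T → V) (t : T) :
    component D t (Pi.single a (Pi.single b v)) = Pi.single a (Pi.single b (v t)) := by
  ext p q
  change (Pi.single a (Pi.single b v) : D → D → T → V) p q t = _
  by_cases hp : p = a <;> by_cases hq : q = b <;> simp [hp, hq]

theorem component_comp_krausIn (A : ∀ i, S i → K i → Matrix D (n i) ℂ) (e : (Σ i, S i) ≃ T)
    (i : κ) (s : S i) :
    component D (e ⟨i, s⟩) ∘ₗ krausIn (V := V) A e = krausMap (A i s) ∘ₗ LinearMap.proj i := by
  refine LinearMap.ext fun x => ?_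
  change (fun p q => krausMap (A (e.symm (e ⟨i, s⟩)).1 _) (x (e.symm (e ⟨i, s⟩)).1) p q) = _
  rw [e.symm_apply_apply]
  rfl

end Definitions

variable [∀ i, DecidableEq (n i)] [∀ i, DecidableEq (S i)] [∀ i, DecidableEq (K i)] [Fintype D]
  {A : ∀ i, S i → K i → Matrix D (n i) ℂ}

theorem krausOut_comp_krausIn [∀ i, Fintype (S i)] {V : Type u} [AddCommGroup V] [Module ℂ V]
    (hA : ∀ i, IsKrausBasis (A i)) (e : (Σ i, S i) ≃ T) :
    krausOut A e ∘ₗ krausIn A e =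
      scale (V := fun i => n i → n i → V) fun i => Fintype.card (S i) * Fintype.card (K i) := by
  have block (i : κ) (s : S i) (v : n i → n i → V) :
      krausMap (fun k => (A i s k)ᴴ) (krausMap (A i s) v) = (Fintype.card (K i) : ℂ) • v := by
    have hterm (k k' : K i) :
        conjBy (A i s k)ᴴ (conjBy (A i s k') v) = if k = k' then v else 0 := by
      rw [conjBy_conjBy, (hA i).isometry]
      split_ifs
      · exact conjBy_one v
      · ext; simp [conjBy]
    simp [krausMap, hterm, ← Nat.cast_smul_eq_nsmul ℂ]
  refine LinearMap.ext fun x => funext fun i => ?_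
  have hcomp (s : S i) : component D (e ⟨i, s⟩) (krausIn A e x) = krausMap (A i s) (x i) :=
    LinearMap.congr_fun (component_comp_krausIn A e i s) x
  simp [krausOut, scale, hcomp, block, ← Nat.cast_smul_eq_nsmul ℂ, smul_smul]

variable {V : Type u} [NormedAddCommGroup V] [NormedSpace ℂ V] {N : MatNorm V} {c : κ → ℂ}

section Tests

variable {W : Type v} [AddCommGroup W] [Module ℂ W] {N' : MatNorm W}

theorem completelyContractive_minNorm_sumInftyNorm
    (hN' : ∀ {ι : Type} [Fintype ι] (x : Matrix ι ι W), 0 ≤ N' ι x) {F : W →ₗ[ℂ] (D → D → T → V)}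
    (h : ∀ t, CompletelyContractive N' (minNorm D N) (component D t ∘ₗ F)) :
    CompletelyContractive N' (minNorm D (sumInftyNorm fun _ : T => N)) F :=
  fun ι _ x => Real.iSup_le (fun t => h t ι x) (hN' x)

theorem completelyContractive_minNorm_sumOneNorm [Fintype T]
    (hN' : ∀ {ι : Type} [Fintype ι] (x : Matrix ι ι W), 0 ≤ N' ι x) {F : W →ₗ[ℂ] (D → D → T → V)}
    (h : ∀ (ρ : Type) [Fintype ρ] (φ : T → V →ₗ[ℂ] (ρ → ρ → ℂ)),
      (∀ t, IsMatrixContraction N (φ t)) → IsMatrixContraction N' (matMap D (sumMap φ) ∘ₗ F)) :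
    CompletelyContractive N' (minNorm D (sumOneNorm fun _ : T => N)) F :=
  fun ι _ x => sumOneNorm_le (hN' x) fun ρ _ φ hφ =>
    (opNorm_ampl_matMap (sumMap φ) (x.map F)).symm.trans_le (h ρ φ hφ ι x)

end Tests

theorem krausIn_completelyContractive_infty [Finite κ] (hN : IsOperatorSpace N)
    (hA : ∀ i, IsKrausBasis (A i)) (e : (Σ i, S i) ≃ T) (hc : ∀ i, ‖c i‖ ≤ 1) :
    CompletelyContractive (sumInftyNorm fun i => minNorm (n i) N)
      (minNorm D (sumInftyNorm fun _ : T => N)) (krausIn A e ∘ₗ scale c) := by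
  refine completelyContractive_minNorm_sumInftyNorm
    (fun x => Real.iSup_nonneg fun i => hN.nonneg _) fun t => ?_
  obtain ⟨⟨i, s⟩, rfl⟩ := e.surjective t
  have hcomp : component D (e ⟨i, s⟩) ∘ₗ krausIn A e ∘ₗ scale c =
      (c i • krausMap (A i s)) ∘ₗ LinearMap.proj (φ := fun i => n i → n i → V) i := by
    rw [← LinearMap.comp_assoc, component_comp_krausIn]
    exact LinearMap.ext fun v => by simp [scale]
  rw [hcomp]
  intro ι _ x
  exact (completelyContractive_smul_krausMap hN ((hA i).isometry s) (hc i) ι _).trans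
    (completelyContractive_proj (N := fun i => minNorm (n i) N) i ι x)

omit [∀ i, Fintype (n i)] [Fintype D] in
theorem matMap_sumMap_apply [Fintype T] {ρ : Type} (φ : T → V →ₗ[ℂ] (ρ → ρ → ℂ))
    (y : D → D → T → V) :
    matMap D (sumMap φ) y = ∑ t, matMap D (φ t) (component D t y) := by
  ext p q
  simp [matMap, sumMap, component]

theorem krausIn_completelyContractive_one [Fintype κ] [Fintype T] [∀ i, Finite (S i)]
    (hN : IsOperatorSpace N) (hA : ∀ i, IsKrausBasis (A i)) (e : (Σ i, S i) ≃ T)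
    (hc : ∀ i, ‖c i‖ * Fintype.card (n i) ≤ 1) :
    CompletelyContractive (sumOneNorm fun i => projNorm (n i) N)
      (minNorm D (sumOneNorm fun _ : T => N)) (krausIn A e ∘ₗ scale c) := by
  have := fun i => Fintype.ofFinite (S i)
  refine completelyContractive_minNorm_sumOneNorm sumOneNorm_nonneg fun ρ _ φ hφ => ?_
  have key : matMap D (sumMap φ) ∘ₗ krausIn A e ∘ₗ scale c = sumMap fun i =>
      c i • ∑ x : S i × K i, matMap D (φ (e ⟨i, x.1⟩)) ∘ₗ conjBy (A i x.1 x.2) := by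
    refine LinearMap.ext fun v => ?_
    have hcomp (i : κ) (s : S i) : component D (e ⟨i, s⟩) (krausIn A e (scale c v)) =
        krausMap (A i s) (c i • v i) := LinearMap.congr_fun (component_comp_krausIn A e i s) _
    simp only [LinearMap.comp_apply, matMap_sumMap_apply]
    rw [← e.sum_comp, Fintype.sum_sigma]
    simp [sumMap, hcomp, krausMap, Fintype.sum_prod_type, Finset.smul_sum]
  rw [key]
  refine isMatrixContraction_sumMap fun i => ?_
  have hu (x : S i × K i) : IsMatrixContraction N (φ (e ⟨i, x.1⟩)) := hφ _
  have htrace := (hA i).trace_eq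
  exact isMatrixContraction_projNorm_smul_sum (fun _ => hN.nonneg _) hu htrace (by simpa using hc i)

omit [∀ i, Fintype (n i)] in
theorem matMap_comp_proj_conjBy {m ρ : Type} (u : V →ₗ[ℂ] (ρ → ρ → ℂ)) (t : T) (B : Matrix m D ℂ)
    (y : D → D → T → V) :
    matMap m (u ∘ₗ LinearMap.proj t) (conjBy B y) = matMap m u (conjBy B (component D t y)) := by
  ext p q
  exact congr_arg (fun v => u v p.1 q.1) (map_conjBy_apply (LinearMap.proj t) B y p.2 q.2)

theorem krausOut_block_completelyContractive [Finite T] [∀ i, Fintype (S i)]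
    (hN : IsOperatorSpace N) (i : κ) (hA : IsKrausBasis (A i)) (e : (Σ i, S i) ≃ T)
    {c : ℂ} (hc : ‖c‖ * Fintype.card (n i) ≤ 1) :
    CompletelyContractive (projNorm D (sumInftyNorm fun _ : T => N)) (minNorm (n i) N)
      (c • LinearMap.proj i ∘ₗ krausOut A e) := by
  have := Fintype.ofFinite T
  have hinf : IsOperatorSpace (sumInftyNorm fun _ : T => N) :=
    isOperatorSpace_sumInftyNorm fun _ => hN
  refine completelyContractive_minNorm hN fun ρ _ u hu => ?_
  have key : matMap (n i) u ∘ₗ (c • LinearMap.proj i ∘ₗ krausOut A e) = c • ∑ x : S i × K i,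
      matMap (n i) (u ∘ₗ LinearMap.proj (e ⟨i, x.1⟩)) ∘ₗ conjBy (A i x.1 x.2)ᴴ := by
    refine LinearMap.ext fun y => ?_
    simp [krausOut, krausMap, matMap_comp_proj_conjBy, Fintype.sum_prod_type]
  have hu' (x : S i × K i) : IsMatrixContraction (sumInftyNorm fun _ : T => N)
      (u ∘ₗ LinearMap.proj (e ⟨i, x.1⟩)) :=
    hu.comp (completelyContractive_proj _)
  have htrace := hA.trace_conjTranspose
  rw [key]
  exact isMatrixContraction_projNorm_smul_sum (fun _ => hinf.nonneg _) hu' htrace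
    (by simpa using hc)

theorem krausOut_completelyContractive_infty [Finite T] [∀ i, Fintype (S i)]
    (hN : IsOperatorSpace N) (hA : ∀ i, IsKrausBasis (A i)) (e : (Σ i, S i) ≃ T)
    (hc : ∀ i, ‖c i‖ * Fintype.card (n i) ≤ 1) :
    CompletelyContractive (projNorm D (sumInftyNorm fun _ : T => N))
      (sumInftyNorm fun i => minNorm (n i) N) (scale c ∘ₗ krausOut A e) := by
  have := Fintype.ofFinite T
  have hinf : IsOperatorSpace (sumInftyNorm fun _ : T => N) :=
    isOperatorSpace_sumInftyNorm fun _ => hN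
  intro ι _ y
  exact Real.iSup_le
    (fun i => krausOut_block_completelyContractive hN i (hA i) e (hc i) ι y)
    (projNorm_nonneg hinf.isMatrixSeminorm y)

theorem krausOut_completelyContractive_one [Fintype κ] [Fintype T] [∀ i, Fintype (S i)]
    (hN : IsOperatorSpace N) (hA : ∀ i, IsKrausBasis (A i)) (e : (Σ i, S i) ≃ T)
    (hc : ∀ i, ‖c i‖ ≤ 1) :
    CompletelyContractive (projNorm D (sumOneNorm fun _ : T => N))
      (sumOneNorm fun i => projNorm (n i) N) (scale c ∘ₗ krausOut A e) := by
  classical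
  have hone : IsOperatorSpace (sumOneNorm fun _ : T => N) :=
    isOperatorSpace_sumOneNorm fun _ => hN.isDominated
  intro ι _ y
  refine sumOneNorm_le (projNorm_nonneg hone.isMatrixSeminorm y) fun ρ _ φ hφ => ?_
  suffices h : IsMatrixContraction (projNorm D (sumOneNorm fun _ : T => N))
      (sumMap φ ∘ₗ scale c ∘ₗ krausOut A e) from h ι y
  refine isMatrixContraction_projNorm ?_
  let ψ (x : Σ i, S i) : V →ₗ[ℂ] (ρ × D → ρ × D → ℂ) :=
    c x.1 • ∑ k, conjBy ((1 : Matrix ρ ρ ℂ) ⊗ₖ (A x.1 x.2 k)ᴴᵀ) ∘ₗ choi (φ x.1)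
  have key : choi (sumMap φ ∘ₗ scale c ∘ₗ krausOut A e) = sumMap fun t => ψ (e.symm t) := by
    refine LinearMap.ext fun v => funext fun p => funext fun q => ?_
    have hψ (x : Σ i, S i) : ψ x = c x.1 • ∑ k, choi (φ x.1 ∘ₗ conjBy (A x.1 x.2 k)ᴴ) := by
      simp only [ψ, choi_comp_conjBy]
    simp only [sumMap, LinearMap.coe_mk, AddHom.coe_mk]
    rw [← e.sum_comp, Fintype.sum_sigma]
    simp only [e.symm_apply_apply, hψ]
    simp [choi, scale, krausOut, krausMap, component_single, Finset.smul_sum]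
  rw [key]
  refine isMatrixContraction_sumMap fun t => ?_
  obtain ⟨⟨i, s⟩, rfl⟩ := e.surjective t
  rw [e.symm_apply_apply]
  have hrow := (opNorm_rowMat_one_kronecker_le (l := ρ) _).trans
    (opNorm_rowMat_le_one ((hA i).isometry_conj s))
  have hchoi := (hφ i).choi hN.isMatrixSeminorm
  exact isMatrixContraction_smul_sum_conjBy (fun _ => hN.nonneg _) (fun _ => hchoi)
    (mul_le_one₀ (hc _) (sq_nonneg _) (pow_le_one₀ (opNorm_nonneg _) hrow))

end KrausSums

section Weyl

open Matrix

/-- The Weyl operator `e_p ↦ ω^{p b} e_{p + a}` of `ℂ^{ℤ/n}`, `ω = exp(2πi/n)`. -/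
noncomputable def weyl (n : ℕ) [NeZero n] (s : ZMod n × ZMod n) : Matrix (ZMod n) (ZMod n) ℂ :=
  of fun a p => if a = p + s.1 then ZMod.stdAddChar (p * s.2) else 0

section

variable {n : ℕ} [NeZero n]

theorem conj_stdAddChar_mul (x y : ZMod n) :
    starRingEnd ℂ (ZMod.stdAddChar x) * ZMod.stdAddChar y = ZMod.stdAddChar (y - x) := by
  rw [sub_eq_add_neg, add_comm, AddChar.map_add_eq_mul, AddChar.map_neg_eq_conj]

theorem weyl_conjTranspose_mul_apply (s s' : ZMod n × ZMod n) (p q : ZMod n) :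
    ((weyl n s)ᴴ * weyl n s') p q =
      if p + s.1 = q + s'.1 then ZMod.stdAddChar (q * s'.2 - p * s.2) else 0 := by
  simp [weyl, mul_apply, apply_ite (starRingEnd ℂ), conj_stdAddChar_mul, eq_comm (a := p + s.1)]

theorem weyl_conjTranspose_mul_self (s : ZMod n × ZMod n) : (weyl n s)ᴴ * weyl n s = 1 := by
  ext p q
  by_cases h : p = q <;> simp [weyl_conjTranspose_mul_apply, one_apply, h]

theorem trace_weyl_conjTranspose_mul (s s' : ZMod n × ZMod n) :
    ((weyl n s)ᴴ * weyl n s').trace = if s = s' then (n : ℂ) else 0 := by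
  simp only [trace, diag_apply, weyl_conjTranspose_mul_apply, add_right_inj, ← mul_sub]
  by_cases h : s.1 = s'.1
  · simp only [h, if_true, AddChar.sum_mulShift _ (ZMod.isPrimitive_stdAddChar n), sub_eq_zero,
      ZMod.card, Prod.ext_iff, true_and, eq_comm, Nat.cast_ite, Nat.cast_zero]
  · simp [h, Prod.ext_iff]

end

variable {n n' D D' S K : Type} [Fintype n] [DecidableEq n] [DecidableEq S] [DecidableEq K]

theorem IsKrausBasis.of_unitary [Fintype K] {U : S → Matrix n n ℂ} (hU : ∀ s, (U s)ᴴ * U s = 1)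
    (htrace : ∀ s s', ((U s)ᴴ * U s').trace = if s = s' then (Fintype.card n : ℂ) else 0) :
    IsKrausBasis fun s k => (of fun a p => if a.2 = k then U s a.1 p else 0 :
      Matrix (n × K) n ℂ) := by
  have hmul (s s' : S) (k k' : K) :
      (of fun a p => if a.2 = k then U s a.1 p else 0 : Matrix (n × K) n ℂ)ᴴ *
        (of fun a p => if a.2 = k' then U s' a.1 p else 0 : Matrix (n × K) n ℂ) =
      if k = k' then (U s)ᴴ * U s' else 0 := by
    ext p q
    by_cases h : k = k'
    · simp [mul_apply, Fintype.sum_prod_type, h, apply_ite star]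
    · simp [mul_apply, Fintype.sum_prod_type, h, apply_ite star, Ne.symm h]
  refine ⟨fun s k k' => by rw [hmul, hU], fun x y => ?_⟩
  rw [hmul, apply_ite trace, htrace, trace_zero]
  simp only [Prod.ext_iff, ite_and]
  split_ifs <;> rfl

theorem IsKrausBasis.submatrix [Fintype n'] [DecidableEq n'] [Fintype D] [Fintype D']
    {A : S → K → Matrix D n ℂ} (hA : IsKrausBasis A) (e : D' ≃ D) (f : n' ≃ n) :
    IsKrausBasis fun s k => (A s k).submatrix e f := by
  have hmul (x y : S × K) :
      ((A x.1 x.2).submatrix e f)ᴴ * (A y.1 y.2).submatrix e f =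
        ((A x.1 x.2)ᴴ * A y.1 y.2).submatrix f f := by
    rw [conjTranspose_submatrix, submatrix_mul_equiv]
  refine ⟨fun s k k' => ?_, fun x y => ?_⟩
  · rw [hmul (s, k) (s, k'), hA.isometry]
    split_ifs <;> simp
  · rw [hmul, Fintype.card_congr f, ← hA.trace_eq]
    exact f.sum_comp fun i => ((A x.1 x.2)ᴴ * A y.1 y.2) i i

theorem exists_isKrausBasis {n d : ℕ} [NeZero n] (hd : n ∣ d) :
    ∃ A : ZMod n × ZMod n → Fin (d / n) → Matrix (Fin d) (Fin n) ℂ, IsKrausBasis A := by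
  have e : Fin d ≃ ZMod n × Fin (d / n) :=
    Fintype.equivOfCardEq (by simp [Nat.mul_div_cancel' hd])
  have h := IsKrausBasis.of_unitary (K := Fin (d / n)) (weyl_conjTranspose_mul_self (n := n))
    (by simpa using trace_weyl_conjTranspose_mul)
  exact ⟨_, h.submatrix e (ZMod.finEquiv n).toEquiv⟩

end Weyl

section Strip

/-- Bounded continuous functions on the closed strip `0 ≤ Re z ≤ 1` that are analytic in the open
strip: the functions used in complex interpolation. -/
def BddHol {X : Type*} [NormedAddCommGroup X] [NormedSpace ℂ X] (f : ℂ → X) : Prop :=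
  DiffContOnCl ℂ f {z : ℂ | 0 < z.re ∧ z.re < 1} ∧
  ∃ B : ℝ, ∀ z : ℂ, 0 ≤ z.re → z.re ≤ 1 → ‖f z‖ ≤ B

variable {X Y : Type*} [NormedAddCommGroup X] [NormedSpace ℂ X] [NormedAddCommGroup Y]
  [NormedSpace ℂ Y]

theorem bddHol_const (x : X) : BddHol fun _ => x :=
  ⟨diffContOnCl_const, ‖x‖, fun _ _ _ => le_rfl⟩

theorem BddHol.add {f g : ℂ → X} (hf : BddHol f) (hg : BddHol g) : BddHol fun z => f z + g z := by
  obtain ⟨hf, B, hB⟩ := hf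
  obtain ⟨hg, B', hB'⟩ := hg
  exact ⟨hf.add hg, B + B', fun z h0 h1 => norm_add_le_of_le (hB z h0 h1) (hB' z h0 h1)⟩

theorem BddHol.smul {c : ℂ → ℂ} {f : ℂ → X} (hc : BddHol c) (hf : BddHol f) :
    BddHol fun z => c z • f z := by
  obtain ⟨hc, B, hB⟩ := hc
  obtain ⟨hf, B', hB'⟩ := hf
  exact ⟨hc.smul hf, B * B', fun z h0 h1 => (norm_smul_le _ _).trans
    (mul_le_mul (hB z h0 h1) (hB' z h0 h1) (norm_nonneg _) ((norm_nonneg _).trans (hB z h0 h1)))⟩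

theorem BddHol.clm (L : X →L[ℂ] Y) {f : ℂ → X} (hf : BddHol f) : BddHol fun z => L (f z) := by
  obtain ⟨hf, B, hB⟩ := hf
  exact ⟨L.differentiable.comp_diffContOnCl hf, ‖L‖ * B,
    fun z h0 h1 => L.le_opNorm_of_le (hB z h0 h1)⟩

section Pi

variable {τ : Type*} [Fintype τ] {X : τ → Type*} [∀ i, NormedAddCommGroup (X i)]
  [∀ i, NormedSpace ℂ (X i)] {f : ℂ → ∀ i, X i}

theorem BddHol.apply (hf : BddHol f) (i : τ) : BddHol fun z => f z i :=
  hf.clm (ContinuousLinearMap.proj i)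

theorem bddHol_pi (hf : ∀ i, BddHol fun z => f z i) : BddHol f := by
  choose hd B hB using hf
  have hB' (i : τ) : B i ≤ ∑ j, |B j| := (le_abs_self _).trans
    (Finset.single_le_sum (f := fun j => |B j|) (fun _ _ => abs_nonneg _) (Finset.mem_univ i))
  exact ⟨⟨differentiableOn_pi.2 fun i => (hd i).1, continuousOn_pi.2 fun i => (hd i).2⟩,
    ∑ j, |B j|, fun z h0 h1 =>
      (pi_norm_le_iff_of_nonneg (Finset.sum_nonneg fun _ _ => abs_nonneg _)).2 fun i =>
        (hB i z h0 h1).trans (hB' i)⟩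

end Pi

theorem bddHol_natCast_cpow {n : ℕ} (hn : 0 < n) {g : ℂ → ℂ} (hg : Differentiable ℂ g)
    (hre : ∀ z : ℂ, 0 ≤ z.re → z.re ≤ 1 → (g z).re ≤ 0) : BddHol fun z => (n : ℂ) ^ g z := by
  refine ⟨(hg.const_cpow (.inl (Nat.cast_ne_zero.2 hn.ne'))).diffContOnCl, 1, fun z h0 h1 => ?_⟩
  rw [Complex.norm_natCast_cpow_of_pos hn]
  exact Real.rpow_le_one_of_one_le_of_nonpos (by exact_mod_cast hn) (hre z h0 h1)

theorem exists_norm_apply_eq_seminorm {p : Seminorm ℂ X} (hp : Continuous p) (x : X) :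
    ∃ L : X →L[ℂ] ℂ, ‖L x‖ = p x ∧ ∀ y, ‖L y‖ ≤ p y := by
  rcases eq_or_ne x 0 with rfl | hx
  · exact ⟨0, by simp, fun y => by simp⟩
  let e := LinearEquiv.toSpanNonzeroSingleton ℂ X x hx
  let l : (ℂ ∙ x) →ₗ[ℂ] ℂ := (p x : ℂ) • e.symm.toLinearMap
  have norm_l (y : ℂ ∙ x) : ‖l y‖ = p y := by
    obtain ⟨c, rfl⟩ := e.surjective y
    have he : (e c : X) = c • x := rfl
    simp [l, he, map_smul_eq_mul, abs_of_nonneg (apply_nonneg p x), mul_comm]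
  obtain ⟨L, hL, hLp⟩ :=
    Module.Dual.exists_continuous_extension_of_le_seminorm _ l hp fun y => (norm_l y).le
  exact ⟨L, (congrArg _ (hL ⟨x, Submodule.mem_span_singleton_self x⟩)).trans (norm_l _), hLp⟩

variable {C θ : ℝ}

theorem BddHol.norm_le_of_boundary {f : ℂ → X} (hf : BddHol f)
    (h0 : ∀ t : ℝ, ‖f (t * Complex.I)‖ ≤ C) (h1 : ∀ t : ℝ, ‖f (1 + t * Complex.I)‖ ≤ C)
    (hθ0 : 0 ≤ θ) (hθ1 : θ ≤ 1) : ‖f θ‖ ≤ C := by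
  obtain ⟨hd, B, hB⟩ := hf
  have hC : 0 ≤ C := (norm_nonneg _).trans (h0 0)
  have boundary (z : ℂ) : z = z.re + z.im * Complex.I := (Complex.re_add_im z).symm
  have hle := Complex.HadamardThreeLines.norm_le_interp_of_mem_verticalClosedStrip₀₁' (z := θ)
    (a := C) (b := C) f (by simp [Complex.HadamardThreeLines.verticalClosedStrip, hθ0, hθ1]) hd
    ⟨B, by rintro _ ⟨z, hz, rfl⟩; exact hB z hz.1 hz.2⟩
    (fun z hz => by rw [boundary z, Set.mem_singleton_iff.1 hz]; simpa using h0 z.im)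
    (fun z hz => by rw [boundary z, Set.mem_singleton_iff.1 hz]; simpa using h1 z.im)
  rwa [Complex.ofReal_re, ← Real.rpow_add_of_nonneg hC (sub_nonneg.2 hθ1) hθ0, sub_add_cancel,
    Real.rpow_one] at hle

theorem BddHol.seminorm_le_of_boundary {f : ℂ → X} (hf : BddHol f) {p : Seminorm ℂ X}
    (hp : Continuous p) (h0 : ∀ t : ℝ, p (f (t * Complex.I)) ≤ C)
    (h1 : ∀ t : ℝ, p (f (1 + t * Complex.I)) ≤ C) (hθ0 : 0 ≤ θ) (hθ1 : θ ≤ 1) : p (f θ) ≤ C := by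
  obtain ⟨L, hL, hLp⟩ := exists_norm_apply_eq_seminorm hp (f θ)
  rw [← hL]
  exact (hf.clm L).norm_le_of_boundary (fun t => (hLp _).trans (h0 t))
    (fun t => (hLp _).trans (h1 t)) hθ0 hθ1

end Strip

section Interpolation

variable {V : Type u} [NormedAddCommGroup V] [NormedSpace ℂ V] {N N₀ N₁ : MatNorm V} {θ : ℝ}
  {ι : Type} [Fintype ι]

section Bounds

variable {x : Matrix ι ι V}

theorem isAdmissible_iff {f : ℂ → ι → ι → V} {C : ℝ} : IsAdmissible N₀ N₁ ι f C ↔ BddHol f ∧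
    (∀ t : ℝ, N₀ ι (Matrix.of (f (t * Complex.I))) ≤ C) ∧
    (∀ t : ℝ, N₁ ι (Matrix.of (f (1 + t * Complex.I))) ≤ C) := by
  rw [IsAdmissible, BddHol, and_assoc]

theorem isAdmissible_const (x : Matrix ι ι V) :
    IsAdmissible N₀ N₁ ι (fun _ => x) (max (N₀ ι x) (N₁ ι x)) :=
  isAdmissible_iff.2 ⟨bddHol_const (X := ι → ι → V) x, fun _ => le_max_left _ _,
    fun _ => le_max_right _ _⟩

theorem interp_le (hN₀ : ∀ x : Matrix ι ι V, 0 ≤ N₀ ι x) {f : ℂ → ι → ι → V} {C : ℝ}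
    (hf : BddHol f) (h0 : ∀ t : ℝ, N₀ ι (Matrix.of (f (t * Complex.I))) ≤ C)
    (h1 : ∀ t : ℝ, N₁ ι (Matrix.of (f (1 + t * Complex.I))) ≤ C) (hx : Matrix.of (f θ) = x) :
    interp θ N₀ N₁ ι x ≤ C :=
  csInf_le ⟨0, fun _ ⟨_, hg, _⟩ => (hN₀ _).trans (hg.2.2.1 0)⟩
    ⟨f, isAdmissible_iff.2 ⟨hf, h0, h1⟩, hx⟩

theorem le_mul_interp {K c : ℝ} (hK : 0 ≤ K) (h : ∀ (f : ℂ → ι → ι → V) (C : ℝ), BddHol f →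
      (∀ t : ℝ, N₀ ι (Matrix.of (f (t * Complex.I))) ≤ C) →
      (∀ t : ℝ, N₁ ι (Matrix.of (f (1 + t * Complex.I))) ≤ C) → Matrix.of (f θ) = x → c ≤ K * C) :
    c ≤ K * interp θ N₀ N₁ ι x := by
  have h' (f : ℂ → ι → ι → V) (C : ℝ) (hf : IsAdmissible N₀ N₁ ι f C) (hx : Matrix.of (f θ) = x) :
      c ≤ K * C :=
    have ⟨hb, h0, h1⟩ := isAdmissible_iff.1 hf
    h f C hb h0 h1 hx
  rcases hK.eq_or_lt with rfl | hK
  · simpa using h' _ _ (isAdmissible_const x) rfl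
  · rw [← div_le_iff₀' hK]
    exact le_csInf ⟨_, _, isAdmissible_const x, rfl⟩ fun C ⟨f, hf, hx⟩ =>
      (div_le_iff₀' hK).2 (h' f C hf hx)

theorem le_interp {c : ℝ} (h : ∀ (f : ℂ → ι → ι → V) (C : ℝ), BddHol f →
      (∀ t : ℝ, N₀ ι (Matrix.of (f (t * Complex.I))) ≤ C) →
      (∀ t : ℝ, N₁ ι (Matrix.of (f (1 + t * Complex.I))) ≤ C) → Matrix.of (f θ) = x → c ≤ C) :
    c ≤ interp θ N₀ N₁ ι x := by
  rw [← one_mul (interp θ N₀ N₁ ι x)]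
  refine le_mul_interp zero_le_one fun f C hf h0 h1 hx => ?_
  rw [one_mul]
  exact h f C hf h0 h1 hx

theorem interp_le_max (hN₀ : ∀ x : Matrix ι ι V, 0 ≤ N₀ ι x) (x : Matrix ι ι V) :
    interp θ N₀ N₁ ι x ≤ max (N₀ ι x) (N₁ ι x) :=
  interp_le hN₀ (bddHol_const (X := ι → ι → V) x) (fun _ => le_max_left _ _)
    (fun _ => le_max_right _ _) rfl

theorem interp_nonneg (hN₀ : ∀ x : Matrix ι ι V, 0 ≤ N₀ ι x) (x : Matrix ι ι V) :
    0 ≤ interp θ N₀ N₁ ι x :=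
  le_interp fun _ _ _ h0 _ _ => (hN₀ _).trans (h0 0)

end Bounds

theorem IsDominated.interp (hN₀ : ∀ {ι : Type} [Fintype ι] (x : Matrix ι ι V), 0 ≤ N₀ ι x)
    (h₀ : IsDominated N₀) (h₁ : IsDominated N₁) : IsDominated (interp θ N₀ N₁) := fun ι _ => by
  obtain ⟨K, hK, h⟩ := h₀ ι
  obtain ⟨K', -, h'⟩ := h₁ ι
  refine ⟨max K K', le_max_of_le_left hK, fun f => (interp_le_max hN₀ _).trans (max_le ?_ ?_)⟩
  · exact (h f).trans (by gcongr; exact le_max_left K K')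
  · exact (h' f).trans (by gcongr; exact le_max_right K K')

theorem IsMatrixSeminorm.interp (h₀ : IsMatrixSeminorm N₀) (h₁ : IsMatrixSeminorm N₁) :
    IsMatrixSeminorm (interp θ N₀ N₁) where
  nonneg := interp_nonneg h₀.nonneg
  add_le x y := by
    rw [← sub_le_iff_le_add]
    refine le_interp fun f C hf hf0 hf1 hx => ?_
    rw [sub_le_comm]
    refine le_interp fun g C' hg hg0 hg1 hy => ?_
    rw [sub_le_iff_le_add']
    exact interp_le h₀.nonneg (hf.add hg)
      (fun t => (h₀.add_le _ _).trans (add_le_add (hf0 t) (hg0 t)))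
      (fun t => (h₁.add_le _ _).trans (add_le_add (hf1 t) (hg1 t))) (hx ▸ hy ▸ rfl)
  smul_le c x := le_mul_interp (norm_nonneg c) fun f C hf hf0 hf1 hx =>
    interp_le h₀.nonneg ((bddHol_const c).smul hf)
      (fun t => (h₀.smul_le c _).trans (mul_le_mul_of_nonneg_left (hf0 t) (norm_nonneg c)))
      (fun t => (h₁.smul_le c _).trans (mul_le_mul_of_nonneg_left (hf1 t) (norm_nonneg c)))
      (hx ▸ rfl)
  submatrix_le e x := le_interp fun f C hf hf0 hf1 hx =>
    interp_le h₀.nonneg (f := fun z r s => f z (e r) (e s))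
      (bddHol_pi fun r => bddHol_pi fun s => (hf.apply (e r)).apply (e s))
      (fun t => (h₀.submatrix_le e _).trans (hf0 t))
      (fun t => (h₁.submatrix_le e _).trans (hf1 t)) (hx ▸ rfl)
  isDominated := h₀.isDominated.interp h₀.nonneg h₁.isDominated

theorem IsMatrixSeminorm.le_of_boundary (hN : IsMatrixSeminorm N) {f : ℂ → ι → ι → V}
    (hf : BddHol f) {C : ℝ} (h0 : ∀ t : ℝ, N ι (Matrix.of (f (t * Complex.I))) ≤ C)
    (h1 : ∀ t : ℝ, N ι (Matrix.of (f (1 + t * Complex.I))) ≤ C) (hθ0 : 0 ≤ θ) (hθ1 : θ ≤ 1) :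
    N ι (Matrix.of (f θ)) ≤ C := by
  let p : Seminorm ℂ (ι → ι → V) := .ofSMulLE (fun x => N ι (Matrix.of x))
    (le_antisymm (by simpa using hN.smul_le 0 (0 : Matrix ι ι V)) (hN.nonneg _))
    (fun x y => hN.add_le (Matrix.of x) (Matrix.of y)) (fun c x => hN.smul_le c (Matrix.of x))
  have hp : Continuous p := by
    obtain ⟨K, hK, h⟩ := hN.isDominated ι
    lift K to NNReal using hK
    refine Seminorm.continuous_of_le (q := K • normSeminorm ℂ (ι → ι → V)) ?_ h
    exact continuous_const.mul continuous_norm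
  exact hf.seminorm_le_of_boundary hp h0 h1 hθ0 hθ1

theorem interp_self (hN : IsMatrixSeminorm N) (hθ0 : 0 ≤ θ) (hθ1 : θ ≤ 1) :
    interp θ N N = N := by
  funext ι _ x
  refine le_antisymm ((interp_le_max hN.nonneg x).trans_eq (max_self _)) ?_
  exact le_interp fun f C hf h0 h1 hx => hx ▸ hN.le_of_boundary hf h0 h1 hθ0 hθ1

/-- Stein interpolation for an analytic family of complete contractions. -/
theorem completelyContractive_interp {W : Type v} [NormedAddCommGroup W] [NormedSpace ℂ W]
    {M₀ M₁ : MatNorm W} (hM₀ : ∀ {ι : Type} [Fintype ι] (x : Matrix ι ι W), 0 ≤ M₀ ι x)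
    {T : ℂ → V →ₗ[ℂ] W} (hT : ∀ f : ℂ → V, BddHol f → BddHol fun z => T z (f z))
    (h0 : ∀ t : ℝ, CompletelyContractive N₀ M₀ (T (t * Complex.I)))
    (h1 : ∀ t : ℝ, CompletelyContractive N₁ M₁ (T (1 + t * Complex.I))) :
    CompletelyContractive (interp θ N₀ N₁) (interp θ M₀ M₁) (T θ) :=
  fun ι _ _ => le_interp fun f _ hf hf0 hf1 hx =>
    interp_le hM₀ (f := fun z r s => T z (f z r s))
      (bddHol_pi fun r => bddHol_pi fun s => hT _ ((hf.apply r).apply s))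
      (fun t => (h0 t ι _).trans (hf0 t)) (fun t => (h1 t ι _).trans (hf1 t)) (hx ▸ rfl)

variable {D : Type} [Fintype D]

theorem completelyContractive_minNorm_interp
    (hN₀ : ∀ {ι : Type} [Fintype ι] (x : Matrix ι ι V), 0 ≤ N₀ ι x) :
    CompletelyContractive (interp θ (minNorm D N₀) (minNorm D N₁)) (minNorm D (interp θ N₀ N₁))
      .id :=
  fun ι _ _ => le_interp fun f _ hf hf0 hf1 hx =>
    interp_le hN₀ (f := fun z (r s : ι × D) => f z r.1 s.1 r.2 s.2)
      (bddHol_pi fun r => bddHol_pi fun s => (((hf.apply r.1).apply s.1).apply r.2).apply s.2)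
      hf0 hf1 (hx ▸ rfl)

theorem BddHol.tensorSandwich {l m : Type} [Fintype l] [Fintype m] {f : ℂ → m → m → V}
    (hf : BddHol f) (α : Matrix ι (l × m) ℂ) (x : Matrix l l (D → D → ℂ))
    (β : Matrix (l × m) ι ℂ) :
    BddHol (X := ι → ι → D → D → V) fun z => tensorSandwich α x (Matrix.of (f z)) β := by
  refine bddHol_pi fun r => bddHol_pi fun s => bddHol_pi fun a => bddHol_pi fun b => ?_
  let L : (m → m → V) →L[ℂ] V := ∑ P : l × m, ∑ Q : l × m, (α r P * x P.1 Q.1 a b * β Q s) •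
    ContinuousLinearMap.proj (R := ℂ) (φ := fun _ : m => V) Q.2 ∘L
      ContinuousLinearMap.proj (φ := fun _ : m => m → V) P.2
  simpa [L, OpSpace.tensorSandwich, sum_apply] using hf.clm L

theorem completelyContractive_interp_projNorm (h₀ : IsMatrixSeminorm N₀)
    (h₁ : IsMatrixSeminorm N₁) :
    CompletelyContractive (projNorm D (interp θ N₀ N₁)) (interp θ (projNorm D N₀) (projNorm D N₁))
      .id := fun ι _ t => le_projNorm fun l m α β x y ht => by
  have hK : 0 ≤ opNorm α * traceNorm D (Fin l) x * opNorm β :=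
    mul_nonneg (mul_nonneg (opNorm_nonneg _) (traceNorm_nonneg x)) (opNorm_nonneg _)
  rw [mul_right_comm]
  refine le_mul_interp hK fun f C hf hf0 hf1 hy => ?_
  rw [mul_right_comm]
  have bound (N : MatNorm V) (hN : IsMatrixSeminorm N) (z : ℂ)
      (hz : N (Fin m) (Matrix.of (f z)) ≤ C) :
      projNorm D N ι (tensorSandwich α x (Matrix.of (f z)) β) ≤
        opNorm α * traceNorm D (Fin l) x * C * opNorm β :=
    (projNorm_tensorSandwich_le hN α x _ β).trans (by
      gcongr
      exacts [opNorm_nonneg _, mul_nonneg (opNorm_nonneg _) (traceNorm_nonneg x)])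
  exact interp_le (projNorm_nonneg h₀) (hf.tensorSandwich α x β) (fun t => bound N₀ h₀ _ (hf0 t))
    (fun t => bound N₁ h₁ _ (hf1 t)) (by rw [hy]; exact ht.symm)

end Interpolation

section CompleteContractions

variable {V W X : Type*} [AddCommGroup V] [Module ℂ V] [AddCommGroup W] [Module ℂ W]
  [AddCommGroup X] [Module ℂ X] {N : MatNorm V} {N' : MatNorm W} {N'' : MatNorm X}

theorem CompletelyContractive.comp {T : W →ₗ[ℂ] X} {S : V →ₗ[ℂ] W}
    (hT : CompletelyContractive N' N'' T) (hS : CompletelyContractive N N' S) :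
    CompletelyContractive N N'' (T ∘ₗ S) :=
  fun ι _ x => (hT ι (x.map S)).trans (hS ι x)

variable {J : V →ₗ[ℂ] W} {R : W →ₗ[ℂ] V}

theorem CompletelyContractive.completeIsometry (hJ : CompletelyContractive N N' J)
    (hR : CompletelyContractive N' N R) (h : R ∘ₗ J = .id) : CompleteIsometry N N' J :=
  fun ι _ x => le_antisymm (hJ ι x) <| by
    have hx : (x.map J).map R = x := by
      ext r s
      exact LinearMap.congr_fun h (x r s)
    exact (congrArg (N ι) hx).symm.trans_le (hR ι (x.map J))

theorem CompletelyContractive.completelyComplemented (hJ : CompletelyContractive N N' J)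
    (hR : CompletelyContractive N' N R) (h : R ∘ₗ J = .id) :
    CompletelyComplemented N' (LinearMap.range J) := by
  refine ⟨J ∘ₗ R, hJ.comp hR, ?_, ?_⟩
  · rw [LinearMap.comp_assoc, ← LinearMap.comp_assoc R J R, h, LinearMap.id_comp]
  · exact LinearMap.range_comp_of_range_eq_top J
      (LinearMap.range_eq_top.2 fun v => ⟨J v, LinearMap.congr_fun h v⟩)

end CompleteContractions

section Schatten

variable {V : Type u} [NormedAddCommGroup V] [NormedSpace ℂ V] {W : Type v} [NormedAddCommGroup W]
  [NormedSpace ℂ W] {N : MatNorm V} {M : MatNorm W}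

theorem completelyContractive_smul
    (hN : ∀ {ι : Type} [Fintype ι] (x : Matrix ι ι V), 0 ≤ N ι x) (hM : IsMatrixSeminorm M)
    {T : V →ₗ[ℂ] W} {K : ℝ} (hT : ∀ (ι : Type) [Fintype ι] (x : Matrix ι ι V),
      M ι (x.map T) ≤ K * N ι x) {c : ℂ} (hc : ‖c‖ * K ≤ 1) :
    CompletelyContractive N M (c • T) := fun ι _ x => by
  calc M ι (x.map (c • T)) = M ι (c • x.map T) := rfl
    _ ≤ ‖c‖ * M ι (x.map T) := hM.smul_le c _
    _ ≤ ‖c‖ * (K * N ι x) := by gcongr; exact hT ι x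
    _ = ‖c‖ * K * N ι x := (mul_assoc _ _ _).symm
    _ ≤ N ι x := mul_le_of_le_one_left (hN x) hc

theorem CompletelyContractive.smul (hN : ∀ {ι : Type} [Fintype ι] (x : Matrix ι ι V), 0 ≤ N ι x)
    (hM : IsMatrixSeminorm M) {T : V →ₗ[ℂ] W} (hT : CompletelyContractive N M T) {c : ℂ}
    (hc : ‖c‖ ≤ 1) : CompletelyContractive N M (c • T) :=
  completelyContractive_smul hN hM (fun ι _ x => (hT ι x).trans_eq (one_mul _).symm)
    (by rwa [mul_one])

theorem toReal_inv_le_one {q : ℝ≥0∞} (hq : 1 ≤ q) : q⁻¹.toReal ≤ 1 := by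
  simpa using ENNReal.toReal_mono ENNReal.one_ne_top (ENNReal.inv_le_one.2 hq)

theorem norm_natCast_cpow_neg_I {n : ℕ} (hn : 0 < n) (t : ℝ) :
    ‖(n : ℂ) ^ (-(t * Complex.I))‖ = 1 := by
  simp [Complex.norm_natCast_cpow_of_pos hn]

theorem norm_natCast_cpow_neg_one_add_I_mul {n : ℕ} (hn : 0 < n) (t : ℝ) :
    ‖(n : ℂ) ^ (-(1 + t * Complex.I))‖ * n = 1 := by
  have : (n : ℝ) ≠ 0 := Nat.cast_ne_zero.2 hn.ne'
  simp [Complex.norm_natCast_cpow_of_pos hn, Real.rpow_neg_one, this]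

theorem norm_natCast_cpow_I_sub_one_mul {n : ℕ} (hn : 0 < n) (t : ℝ) :
    ‖(n : ℂ) ^ (t * Complex.I - 1)‖ * n = 1 := by
  have : (n : ℝ) ≠ 0 := Nat.cast_ne_zero.2 hn.ne'
  simp [Complex.norm_natCast_cpow_of_pos hn, Real.rpow_neg_one, this]

theorem norm_natCast_cpow_one_add_I_sub_one {n : ℕ} (hn : 0 < n) (t : ℝ) :
    ‖(n : ℂ) ^ (1 + t * Complex.I - 1)‖ = 1 := by
  simp [Complex.norm_natCast_cpow_of_pos hn]

theorem bddHol_natCast_cpow_neg {n : ℕ} (hn : 0 < n) : BddHol fun z => (n : ℂ) ^ (-z) :=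
  bddHol_natCast_cpow hn differentiable_neg fun z h0 _ => by simpa using h0

theorem bddHol_natCast_cpow_sub_one {n : ℕ} (hn : 0 < n) : BddHol fun z => (n : ℂ) ^ (z - 1) :=
  bddHol_natCast_cpow hn (differentiable_id.sub_const 1) fun z _ h1 => by simpa using h1

variable {D : Type} [Fintype D] [Nonempty D]

theorem CompletelyContractive.to_schattenNorm {q : ℝ≥0∞} (hq : 1 ≤ q) (hN : IsMatrixSeminorm N)
    (hM : IsMatrixSeminorm M) {T : V →ₗ[ℂ] D → D → W} (hc : Continuous T)
    (hT : CompletelyContractive N (minNorm D M) T) :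
    CompletelyContractive N (schattenNorm q D M)
      ((Fintype.card D : ℂ) ^ (-(q⁻¹.toReal : ℂ)) • T) := by
  have hsmul (c : ℂ) (ι : Type) [Fintype ι] (x : Matrix ι ι V) :
      minNorm D M ι (x.map (c • T)) ≤ ‖c‖ * N ι x :=
    (hM.smul_le c _).trans (mul_le_mul_of_nonneg_left (hT ι x) (norm_nonneg c))
  have left (t : ℝ) : CompletelyContractive N (minNorm D M)
      ((Fintype.card D : ℂ) ^ (-(t * Complex.I)) • T) := fun ι _ x => by
    refine (hsmul _ ι x).trans_eq ?_
    rw [norm_natCast_cpow_neg_I Fintype.card_pos, one_mul]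
  have right (t : ℝ) : CompletelyContractive N (projNorm D M)
      ((Fintype.card D : ℂ) ^ (-(1 + t * Complex.I)) • T) := fun ι _ x => by
    refine ((projNorm_le_card_mul_minNorm hM _).trans
      (mul_le_mul_of_nonneg_left (hsmul _ ι x) (Nat.cast_nonneg _))).trans_eq ?_
    rw [← mul_assoc, mul_comm (Fintype.card D : ℝ),
      norm_natCast_cpow_neg_one_add_I_mul Fintype.card_pos, one_mul]
  have h := completelyContractive_interp (θ := q⁻¹.toReal)
    (T := fun z => (Fintype.card D : ℂ) ^ (-z) • T) (fun x => hM.nonneg _)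
    (fun f hf => (bddHol_natCast_cpow_neg Fintype.card_pos).smul (hf.clm ⟨T, hc⟩)) left right
  rwa [interp_self hN ENNReal.toReal_nonneg (toReal_inv_le_one hq)] at h

theorem CompletelyContractive.of_schattenNorm {q : ℝ≥0∞} (hq : 1 ≤ q) (hN : IsMatrixSeminorm N)
    (hM : IsMatrixSeminorm M) {T : (D → D → V) →ₗ[ℂ] W} (hc : Continuous T)
    (hT : CompletelyContractive (projNorm D N) M T) :
    CompletelyContractive (schattenNorm q D N) M
      ((Fintype.card D : ℂ) ^ ((q⁻¹.toReal : ℂ) - 1) • T) := by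
  have left (t : ℝ) : CompletelyContractive (minNorm D N) M
      ((Fintype.card D : ℂ) ^ (t * Complex.I - 1) • T) :=
    completelyContractive_smul (fun x => hN.nonneg _) hM
      (fun ι _ x => (hT ι x).trans (projNorm_le_card_mul_minNorm hN x))
      (norm_natCast_cpow_I_sub_one_mul Fintype.card_pos t).le
  have right (t : ℝ) : CompletelyContractive (projNorm D N) M
      ((Fintype.card D : ℂ) ^ (1 + t * Complex.I - 1) • T) :=
    hT.smul (projNorm_nonneg hN) hM (norm_natCast_cpow_one_add_I_sub_one Fintype.card_pos t).le
  have h := completelyContractive_interp (θ := q⁻¹.toReal)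
    (T := fun z => (Fintype.card D : ℂ) ^ (z - 1) • T) hM.nonneg
    (fun f hf => (bddHol_natCast_cpow_sub_one Fintype.card_pos).smul (hf.clm ⟨T, hc⟩)) left right
  rwa [interp_self hM ENNReal.toReal_nonneg (toReal_inv_le_one hq)] at h

end Schatten

section Embedding

open Matrix

section Continuity

variable {V : Type u} [AddCommGroup V] [Module ℂ V] [TopologicalSpace V] [ContinuousAdd V]
  [ContinuousConstSMul ℂ V]

theorem continuous_krausMap {n m K : Type} [Fintype n] [Fintype K] (B : K → Matrix m n ℂ) :
    Continuous (krausMap (V := V) B) := by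
  have h (k : K) : Continuous (conjBy (V := V) (B k)) := by
    change Continuous fun (x : n → n → V) i j => ∑ a, ∑ b, (B k i a * star (B k j b)) • x a b
    fun_prop
  rw [krausMap, LinearMap.coe_sum]
  exact (continuous_finsetSum _ fun k _ => h k).congr fun x => (Finset.sum_apply x _ _).symm

variable {κ D T : Type} {n S K : κ → Type} [∀ i, Fintype (K i)]
  (A : ∀ i, S i → K i → Matrix D (n i) ℂ) (e : (Σ i, S i) ≃ T)

theorem continuous_krausIn [∀ i, Fintype (n i)] : Continuous (krausIn (V := V) A e) :=
  continuous_pi fun p => continuous_pi fun q => continuous_pi fun _ =>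
    (continuous_apply_apply p q).comp ((continuous_krausMap _).comp (continuous_apply _))

theorem continuous_krausOut [Fintype D] [∀ i, Fintype (S i)] :
    Continuous (krausOut (V := V) A e) := by
  have h (t : T) : Continuous (component (V := V) D t) := continuous_pi fun p =>
    continuous_pi fun q => (continuous_apply t).comp (continuous_apply_apply p q)
  refine continuous_pi fun i => ?_
  simp only [krausOut, LinearMap.pi_apply, LinearMap.sum_apply, LinearMap.comp_apply]
  exact continuous_finsetSum _ fun s _ => (continuous_krausMap _).comp (h _)

theorem continuous_scale {V : κ → Type u} [∀ i, AddCommGroup (V i)] [∀ i, Module ℂ (V i)]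
    [∀ i, TopologicalSpace (V i)] [∀ i, ContinuousConstSMul ℂ (V i)] (c : κ → ℂ) :
    Continuous (scale (V := V) c) :=
  continuous_pi fun i => (continuous_apply i).const_smul (c i)

end Continuity

theorem BddHol.scale {κ : Type} [Fintype κ] {V : κ → Type u} [∀ i, NormedAddCommGroup (V i)]
    [∀ i, NormedSpace ℂ (V i)] {c : ℂ → κ → ℂ} (hc : ∀ i, BddHol fun z => c z i)
    {f : ℂ → ∀ i, V i} (hf : BddHol f) : BddHol fun z => scale (c z) (f z) :=
  bddHol_pi fun i => (hc i).smul (hf.apply i)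

section Interpolation

variable {κ D T : Type} {n S K : κ → Type} [Fintype κ] [Fintype D] [Fintype T]
  [∀ i, Fintype (n i)] [∀ i, DecidableEq (n i)] [∀ i, Nonempty (n i)] [∀ i, DecidableEq (S i)]
  [∀ i, Fintype (K i)] [∀ i, DecidableEq (K i)] {A : ∀ i, S i → K i → Matrix D (n i) ℂ}
  {V : Type u} [NormedAddCommGroup V] [NormedSpace ℂ V] {N : MatNorm V}

theorem krausIn_completelyContractive_sumNorm [∀ i, Finite (S i)] (p : ℝ≥0∞)
    (hN : IsOperatorSpace N) (hA : ∀ i, IsKrausBasis (A i)) (e : (Σ i, S i) ≃ T) :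
    CompletelyContractive (sumNorm p (fun i => minNorm (n i) N) fun i => projNorm (n i) N)
      (minNorm D (sumNorm p (fun _ : T => N) fun _ => N))
      (krausIn A e ∘ₗ scale fun i => (Fintype.card (n i) : ℂ) ^ (-(p⁻¹.toReal : ℂ))) := by
  have hinf : IsOperatorSpace (sumInftyNorm fun _ : T => N) :=
    isOperatorSpace_sumInftyNorm fun _ => hN
  let F (z : ℂ) : (∀ i, n i → n i → V) →ₗ[ℂ] (D → D → T → V) :=
    krausIn A e ∘ₗ scale fun i => (Fintype.card (n i) : ℂ) ^ (-z)
  have analytic (f : ℂ → ∀ i, n i → n i → V) (hf : BddHol f) : BddHol fun z => F z (f z) :=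
    (BddHol.scale (fun i => bddHol_natCast_cpow_neg Fintype.card_pos) hf).clm
      ⟨krausIn A e, continuous_krausIn A e⟩
  have left (t : ℝ) := krausIn_completelyContractive_infty hN hA e fun i =>
    (norm_natCast_cpow_neg_I (Fintype.card_pos (α := n i)) t).le
  have right (t : ℝ) := krausIn_completelyContractive_one hN hA e fun i =>
    (norm_natCast_cpow_neg_one_add_I_mul (Fintype.card_pos (α := n i)) t).le
  have stein := completelyContractive_interp (θ := p⁻¹.toReal) (T := F) hinf.minNorm.nonneg
    analytic left right
  have amplified := completelyContractive_minNorm_interp (θ := p⁻¹.toReal) (D := D)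
    (N₁ := sumOneNorm fun _ : T => N) hinf.nonneg
  rw [sumNorm, sumNorm]
  exact (amplified.comp stein :)

theorem krausOut_completelyContractive_sumNorm [∀ i, Fintype (S i)] (p : ℝ≥0∞)
    (hN : IsOperatorSpace N) (hA : ∀ i, IsKrausBasis (A i)) (e : (Σ i, S i) ≃ T) :
    CompletelyContractive (projNorm D (sumNorm p (fun _ : T => N) fun _ => N))
      (sumNorm p (fun i => minNorm (n i) N) fun i => projNorm (n i) N)
      ((scale fun i => (Fintype.card (n i) : ℂ) ^ ((p⁻¹.toReal : ℂ) - 1)) ∘ₗ krausOut A e) := by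
  have hinf : IsOperatorSpace (sumInftyNorm fun _ : T => N) :=
    isOperatorSpace_sumInftyNorm fun _ => hN
  have hone : IsOperatorSpace (sumOneNorm fun _ : T => N) :=
    isOperatorSpace_sumOneNorm fun _ => hN.isDominated
  let F (z : ℂ) : (D → D → T → V) →ₗ[ℂ] (∀ i, n i → n i → V) :=
    (scale fun i => (Fintype.card (n i) : ℂ) ^ (z - 1)) ∘ₗ krausOut A e
  have analytic (f : ℂ → D → D → T → V) (hf : BddHol f) : BddHol fun z => F z (f z) :=
    (hf.clm ⟨krausOut A e, continuous_krausOut A e⟩).scale fun i =>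
      bddHol_natCast_cpow_sub_one Fintype.card_pos
  have left (t : ℝ) := krausOut_completelyContractive_infty hN hA e fun i =>
    (norm_natCast_cpow_I_sub_one_mul (Fintype.card_pos (α := n i)) t).le
  have right (t : ℝ) := krausOut_completelyContractive_one hN hA e fun i =>
    (norm_natCast_cpow_one_add_I_sub_one (Fintype.card_pos (α := n i)) t).le
  have stein := completelyContractive_interp (θ := p⁻¹.toReal) (T := F)
    (isOperatorSpace_sumInftyNorm fun i => hN.minNorm).nonneg analytic left right
  have amplified := completelyContractive_interp_projNorm (θ := p⁻¹.toReal) (D := D)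
    hinf.isMatrixSeminorm hone.isMatrixSeminorm
  rw [sumNorm, sumNorm]
  exact (stein.comp amplified :)

end Interpolation

end Embedding

section Retract

open Matrix

variable {κ D T : Type} {n S K : κ → Type} [∀ i, Fintype (n i)] [∀ i, Fintype (K i)] [Fintype D]

section Definitions

variable {V : Type u} [AddCommGroup V] [Module ℂ V]

/-- The map `J ⊗ id_V`: `krausIn`, normalized by `|n_i|^{-1/p}` on the `i`-th block and by
`|D|^{-1/q}`. -/
noncomputable def embedding (p q : ℝ≥0∞) (A : ∀ i, S i → K i → Matrix D (n i) ℂ)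
    (e : (Σ i, S i) ≃ T) : (∀ i, n i → n i → V) →ₗ[ℂ] (D → D → T → V) :=
  (Fintype.card D : ℂ) ^ (-(q⁻¹.toReal : ℂ)) •
    (krausIn A e ∘ₗ scale fun i => (Fintype.card (n i) : ℂ) ^ (-(p⁻¹.toReal : ℂ)))

/-- The map `W ⊗ id_V`: `krausOut`, normalized by `|n_i|^{1/p-1}` on the `i`-th block and by
`|D|^{1/q-1}`. -/
noncomputable def retraction [∀ i, Fintype (S i)] (p q : ℝ≥0∞)
    (A : ∀ i, S i → K i → Matrix D (n i) ℂ) (e : (Σ i, S i) ≃ T) :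
    (D → D → T → V) →ₗ[ℂ] (∀ i, n i → n i → V) :=
  (Fintype.card D : ℂ) ^ ((q⁻¹.toReal : ℂ) - 1) •
    ((scale fun i => (Fintype.card (n i) : ℂ) ^ ((p⁻¹.toReal : ℂ) - 1)) ∘ₗ krausOut A e)

theorem map_krausMap_apply {m n K : Type} [Fintype n] [Fintype K] {W : Type v} [AddCommGroup W]
    [Module ℂ W] (L : V →ₗ[ℂ] W) (B : K → Matrix m n ℂ) (x : n → n → V) (i j : m) :
    L (krausMap B x i j) = krausMap B (fun a b => L (x a b)) i j := by
  simp [krausMap, map_conjBy_apply]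

variable {W : Type v} [AddCommGroup W] [Module ℂ W] (L : V →ₗ[ℂ] W) (p q : ℝ≥0∞)
  (A : ∀ i, S i → K i → Matrix D (n i) ℂ) (e : (Σ i, S i) ≃ T)

theorem embedding_map (x : ∀ i, n i → n i → V) :
    embedding p q A e (fun i a b => L (x i a b)) = fun a b t => L (embedding p q A e x a b t) := by
  ext a b t
  simp [embedding, krausIn, scale, map_krausMap_apply]

theorem retraction_map [∀ i, Fintype (S i)] (y : D → D → T → V) :
    retraction p q A e (fun a b t => L (y a b t)) =
      fun i a b => L (retraction p q A e y i a b) := by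
  ext i a b
  simp [retraction, krausOut, scale, component, map_krausMap_apply]
  rfl

theorem natCast_cpow_sub_one_mul_cpow_neg {n : ℕ} (hn : 0 < n) (z : ℂ) :
    (n : ℂ) ^ (z - 1) * (n : ℂ) ^ (-z) = (n : ℂ)⁻¹ := by
  rw [← Complex.cpow_add _ _ (Nat.cast_ne_zero.2 hn.ne'), ← Complex.cpow_neg_one]
  congr 1
  ring

theorem retraction_comp_embedding [∀ i, Fintype (S i)] [∀ i, DecidableEq (n i)]
    [∀ i, DecidableEq (S i)] [∀ i, DecidableEq (K i)] [∀ i, Nonempty (n i)] [Nonempty D]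
    (hA : ∀ i, IsKrausBasis (A i))
    (hcard : ∀ i, Fintype.card (S i) * Fintype.card (K i) = Fintype.card (n i) * Fintype.card D) :
    retraction p q A e ∘ₗ embedding p q A e = (.id : (∀ i, n i → n i → V) →ₗ[ℂ] _) := by
  have hD := natCast_cpow_sub_one_mul_cpow_neg (Fintype.card_pos (α := D)) q⁻¹.toReal
  have hn (i : κ) := natCast_cpow_sub_one_mul_cpow_neg (Fintype.card_pos (α := n i)) p⁻¹.toReal
  have hcard' (i : κ) : (Fintype.card (S i) * Fintype.card (K i) : ℂ) =
      Fintype.card (n i) * Fintype.card D := by exact_mod_cast hcard i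
  have hscale (i : κ) : (Fintype.card D : ℂ)⁻¹ * ((Fintype.card (n i) : ℂ) ^ (p⁻¹.toReal - 1 : ℂ) *
      (Fintype.card (S i) * Fintype.card (K i) *
        (Fintype.card (n i) : ℂ) ^ (-p⁻¹.toReal : ℂ))) = 1 := by
    rw [mul_left_comm ((Fintype.card (n i) : ℂ) ^ _), hn, hcard']
    have := Fintype.card_ne_zero (α := D)
    have := Fintype.card_ne_zero (α := n i)
    field_simp
  rw [retraction, embedding, LinearMap.smul_comp, LinearMap.comp_smul, smul_smul, hD,
    LinearMap.comp_assoc, ← LinearMap.comp_assoc _ _ (krausOut A e), krausOut_comp_krausIn hA]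
  refine LinearMap.ext fun x => funext fun i => ?_
  simp only [scale, LinearMap.smul_apply, LinearMap.comp_apply, LinearMap.pi_apply, Pi.smul_apply,
    LinearMap.proj_apply, smul_smul, hscale, one_smul, LinearMap.id_apply]

end Definitions

section CompleteContractivity

variable {V : Type u} [NormedAddCommGroup V] [NormedSpace ℂ V] {N : MatNorm V} {p q : ℝ≥0∞}

theorem isMatrixSeminorm_sumNorm [Fintype κ] {V : κ → Type u} [∀ i, NormedAddCommGroup (V i)]
    [∀ i, NormedSpace ℂ (V i)] {N₀ N₁ : ∀ i, MatNorm (V i)} (h₀ : ∀ i, IsOperatorSpace (N₀ i))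
    (h₁ : ∀ i, IsDominated (N₁ i)) : IsMatrixSeminorm (sumNorm p N₀ N₁) :=
  (isOperatorSpace_sumInftyNorm h₀).isMatrixSeminorm.interp
    (isOperatorSpace_sumOneNorm h₁).isMatrixSeminorm

variable [Fintype κ] [Fintype T] [∀ i, DecidableEq (n i)] [∀ i, DecidableEq (S i)]
  [∀ i, DecidableEq (K i)] [∀ i, Nonempty (n i)] [Nonempty D]
  {A : ∀ i, S i → K i → Matrix D (n i) ℂ}

theorem embedding_completelyContractive [∀ i, Finite (S i)] (hq : 1 ≤ q)
    (hN : IsOperatorSpace N) (hA : ∀ i, IsKrausBasis (A i)) (e : (Σ i, S i) ≃ T) :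
    CompletelyContractive (sumNorm p (fun i => minNorm (n i) N) fun i => projNorm (n i) N)
      (schattenNorm q D (sumNorm p (fun _ : T => N) fun _ => N)) (embedding p q A e) :=
  CompletelyContractive.to_schattenNorm hq
    (isMatrixSeminorm_sumNorm (fun _ => hN.minNorm) fun _ => .projNorm hN.isMatrixSeminorm)
    (isMatrixSeminorm_sumNorm (fun _ => hN) fun _ => hN.isDominated)
    ((continuous_krausIn A e).comp (continuous_scale _))
    (krausIn_completelyContractive_sumNorm p hN hA e)

theorem retraction_completelyContractive [∀ i, Fintype (S i)] (hq : 1 ≤ q)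
    (hN : IsOperatorSpace N) (hA : ∀ i, IsKrausBasis (A i)) (e : (Σ i, S i) ≃ T) :
    CompletelyContractive (schattenNorm q D (sumNorm p (fun _ : T => N) fun _ => N))
      (sumNorm p (fun i => minNorm (n i) N) fun i => projNorm (n i) N) (retraction p q A e) :=
  CompletelyContractive.of_schattenNorm hq
    (isMatrixSeminorm_sumNorm (fun _ => hN) fun _ => hN.isDominated)
    (isMatrixSeminorm_sumNorm (fun _ => hN.minNorm) fun _ => .projNorm hN.isMatrixSeminorm)
    ((continuous_scale _).comp (continuous_krausOut A e))
    (krausOut_completelyContractive_sumNorm p hN hA e)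

end CompleteContractivity

end Retract

section Positivity

open Matrix
open scoped ComplexOrder Kronecker

theorem natCast_cpow_ofReal_nonneg (n : ℕ) (x : ℝ) : 0 ≤ (n : ℂ) ^ (x : ℂ) := by
  rw [← Complex.ofReal_natCast, ← Complex.ofReal_cpow (Nat.cast_nonneg n)]
  exact Complex.zero_le_real.2 (by positivity)

section

variable {V : Type u} [AddCommGroup V] [Module ℂ V] {m n ι K : Type} {x : Matrix ι ι V}

theorem posSemidef_ampl_sum [Fintype K] {u : K → V →ₗ[ℂ] (n → n → ℂ)}
    (h : ∀ k, (ampl (u k) x).PosSemidef) : (ampl (∑ k, u k) x).PosSemidef := by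
  have hsum : ampl (∑ k, u k) x = ∑ k, ampl (u k) x := by
    ext r s
    simp [ampl_apply, Matrix.sum_apply]
  exact hsum ▸ posSemidef_sum _ fun k _ => h k

theorem posSemidef_ampl_krausMap_comp [Fintype n] [Fintype K] [Finite m] [Finite ι]
    (B : K → Matrix m n ℂ) {u : V →ₗ[ℂ] (n → n → ℂ)} (hx : (ampl u x).PosSemidef) :
    (ampl (krausMap B ∘ₗ u) x).PosSemidef := by
  classical
  have := Fintype.ofFinite m
  have := Fintype.ofFinite ι
  have hcomp : krausMap B ∘ₗ u = ∑ k, conjBy (B k) ∘ₗ u := by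
    ext v
    simp [krausMap]
  rw [hcomp]
  exact posSemidef_ampl_sum fun k =>
    ampl_conjBy_comp (B k) u x ▸ hx.mul_mul_conjTranspose_same _

theorem posSemidef_ampl_smul {u : V →ₗ[ℂ] (n → n → ℂ)} {c : ℂ} (hc : 0 ≤ c)
    (hx : (ampl u x).PosSemidef) : (ampl (c • u) x).PosSemidef :=
  hx.smul hc

end

variable {k d m : ℕ} {n : Fin k → ℕ} {S K : Fin k → Type} [∀ i, Fintype (K i)]
  (p q : ℝ≥0∞) (A : ∀ i, S i → K i → Matrix (Fin d) (Fin (n i)) ℂ) (e : (Σ i, S i) ≃ Fin m)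

theorem completelyPositive_embedding :
    CompletelyPositive (blockSumCone n) (matEllCone d m) (embedding p q A e) := by
  intro ι _ x hx t
  obtain ⟨⟨i, s⟩, rfl⟩ := e.surjective t
  have hD : 0 ≤ (Fintype.card (Fin d) : ℂ) ^ (-(q⁻¹.toReal : ℂ)) :=
    mod_cast natCast_cpow_ofReal_nonneg _ (-q⁻¹.toReal)
  have hn : 0 ≤ (Fintype.card (Fin (n i)) : ℂ) ^ (-(p⁻¹.toReal : ℂ)) :=
    mod_cast natCast_cpow_ofReal_nonneg _ (-p⁻¹.toReal)
  have hcomp : component (Fin d) (e ⟨i, s⟩) ∘ₗ embedding (V := ℂ) p q A e =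
      (Fintype.card (Fin d) : ℂ) ^ (-(q⁻¹.toReal : ℂ)) •
        (krausMap (A i s) ∘ₗ ((Fintype.card (Fin (n i)) : ℂ) ^ (-(p⁻¹.toReal : ℂ)) •
          LinearMap.proj (R := ℂ) (φ := fun i => Fin (n i) → Fin (n i) → ℂ) i)) := by
    rw [embedding, LinearMap.comp_smul, ← LinearMap.comp_assoc, component_comp_krausIn]
    rfl
  have hx' : (ampl (LinearMap.proj i : BlockSum n ℂ →ₗ[ℂ] _) x).PosSemidef := hx i
  change (ampl (component (Fin d) (e ⟨i, s⟩) ∘ₗ embedding p q A e) x).PosSemidef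
  rw [hcomp]
  exact posSemidef_ampl_smul hD (posSemidef_ampl_krausMap_comp _ (posSemidef_ampl_smul hn hx'))

theorem completelyPositive_retraction [∀ i, Fintype (S i)] :
    CompletelyPositive (matEllCone d m) (blockSumCone n) (retraction p q A e) := by
  intro ι _ y hy i
  have hD : 0 ≤ (Fintype.card (Fin d) : ℂ) ^ ((q⁻¹.toReal : ℂ) - 1) :=
    mod_cast natCast_cpow_ofReal_nonneg _ (q⁻¹.toReal - 1)
  have hn : 0 ≤ (Fintype.card (Fin (n i)) : ℂ) ^ ((p⁻¹.toReal : ℂ) - 1) :=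
    mod_cast natCast_cpow_ofReal_nonneg _ (p⁻¹.toReal - 1)
  have hcomp : LinearMap.proj (R := ℂ) (φ := fun i => Fin (n i) → Fin (n i) → ℂ) i ∘ₗ
      retraction p q A e = (Fintype.card (Fin d) : ℂ) ^ ((q⁻¹.toReal : ℂ) - 1) •
        (Fintype.card (Fin (n i)) : ℂ) ^ ((p⁻¹.toReal : ℂ) - 1) •
          ∑ s, krausMap (fun k => (A i s k)ᴴ) ∘ₗ component (Fin d) (e ⟨i, s⟩) := by
    rw [retraction, LinearMap.comp_smul]
    rfl
  have hpos : (ampl (∑ s, krausMap (fun k => (A i s k)ᴴ) ∘ₗ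
      component (Fin d) (e ⟨i, s⟩)) y).PosSemidef :=
    posSemidef_ampl_sum fun s => posSemidef_ampl_krausMap_comp
      (u := component (Fin d) (e ⟨i, s⟩)) _ (hy (e ⟨i, s⟩))
  change (ampl (LinearMap.proj (R := ℂ) (φ := fun i => Fin (n i) → Fin (n i) → ℂ) i ∘ₗ
    retraction p q A e) y).PosSemidef
  rw [hcomp]
  exact posSemidef_ampl_smul hD (posSemidef_ampl_smul hn hpos)

end Positivity

theorem theorem1p1_general (p q : ℝ≥0∞) (_hp : 1 ≤ p) (hq : 1 ≤ q) {k : ℕ} (n : Fin k → ℕ)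
    (hn : ∀ i, 0 < n i) (d m : ℕ) (hd : 0 < d) (hdvd : ∀ i, n i ∣ d) (hm : m = ∑ i, n i ^ 2) :
    ∃ (J : BlockSum n ℂ →ₗ[ℂ] MatEll d m ℂ) (W : MatEll d m ℂ →ₗ[ℂ] BlockSum n ℂ),
      CompletelyPositive (blockSumCone n) (matEllCone d m) J ∧
      CompletelyPositive (matEllCone d m) (blockSumCone n) W ∧
      CompleteIsometry (schattenSumNorm p n scalarNorm) (schattenEllNorm q p d m scalarNorm) J ∧
      CompletelyContractive (schattenEllNorm q p d m scalarNorm)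
        (schattenSumNorm p n scalarNorm) W ∧
      W ∘ₗ J = LinearMap.id ∧
      ∀ (V : Type u) [NormedAddCommGroup V] [NormedSpace ℂ V] (N : MatNorm V), IsOperatorSpace N →
        ∃ (JV : BlockSum n V →ₗ[ℂ] MatEll d m V) (WV : MatEll d m V →ₗ[ℂ] BlockSum n V),
          (∀ (x : BlockSum n ℂ) (v : V),
            JV (fun i a b => x i a b • v) = fun a b j => J x a b j • v) ∧
          (∀ (y : MatEll d m ℂ) (v : V),
            WV (fun a b j => y a b j • v) = fun i a b => W y i a b • v) ∧
          CompleteIsometry (schattenSumNorm p n N) (schattenEllNorm q p d m N) JV ∧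
          CompletelyContractive (schattenEllNorm q p d m N) (schattenSumNorm p n N) WV ∧
          WV ∘ₗ JV = LinearMap.id ∧
          CompletelyComplemented (schattenEllNorm q p d m N) (LinearMap.range JV) := by
  have (i : Fin k) : NeZero (n i) := ⟨(hn i).ne'⟩
  have : NeZero d := ⟨hd.ne'⟩
  choose A hA using fun i => exists_isKrausBasis (hdvd i)
  have e : (Σ i, ZMod (n i) × ZMod (n i)) ≃ Fin m :=
    Fintype.equivFinOfCardEq (by simp [hm, sq])
  have hcard (i : Fin k) : Fintype.card (ZMod (n i) × ZMod (n i)) * Fintype.card (Fin (d / n i)) =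
      Fintype.card (Fin (n i)) * Fintype.card (Fin d) := by
    simp [mul_assoc, Nat.mul_div_cancel' (hdvd i)]
  have hJ := embedding_completelyContractive (p := p) hq isOperatorSpace_scalarNorm hA e
  have hW := retraction_completelyContractive (p := p) hq isOperatorSpace_scalarNorm hA e
  have hWJ := retraction_comp_embedding (V := ℂ) p q A e hA hcard
  refine ⟨embedding p q A e, retraction p q A e, completelyPositive_embedding p q A e,
    completelyPositive_retraction p q A e, hJ.completeIsometry hW hWJ, hW, hWJ,
    fun V _ _ N hN => ?_⟩
  have hJV := embedding_completelyContractive (p := p) hq hN hA e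
  have hWV := retraction_completelyContractive (p := p) hq hN hA e
  have hWJV := retraction_comp_embedding (V := V) p q A e hA hcard
  exact ⟨embedding p q A e, retraction p q A e,
    fun x v => embedding_map (.toSpanSingleton ℂ V v) p q A e x,
    fun y v => retraction_map (.toSpanSingleton ℂ V v) p q A e y,
    hJV.completeIsometry hWV hWJV, hWV, hWJV, hJV.completelyComplemented hWV hWJV⟩

end OpSpace

/-- Scalar part: `J` and `W`. Vector-valued part: for every operator space, that is, every closed
subspace `E` of some `B(H)`, the amplifications `JE = J ⊗ id_E` and `WE = W ⊗ id_E`. -/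
theorem theorem1p1 (p q : ℝ≥0∞) (hp : 1 ≤ p) (hq : 1 ≤ q) {k : ℕ} (n : Fin k → ℕ)
    (hn : ∀ i, 0 < n i) (d m : ℕ) (hd : d = Finset.univ.lcm n) (hm : m = ∑ i, n i ^ 2) :
    ∃ (J : BlockSum n ℂ →ₗ[ℂ] MatEll d m ℂ) (W : MatEll d m ℂ →ₗ[ℂ] BlockSum n ℂ),
      CompletelyPositive (blockSumCone n) (matEllCone d m) J ∧
      CompletelyPositive (matEllCone d m) (blockSumCone n) W ∧
      CompleteIsometry (schattenSumNorm p n scalarNorm) (schattenEllNorm q p d m scalarNorm) J ∧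
      CompletelyContractive (schattenEllNorm q p d m scalarNorm)
        (schattenSumNorm p n scalarNorm) W ∧
      W ∘ₗ J = LinearMap.id ∧
      ∀ (H : Type u) [NormedAddCommGroup H] [InnerProductSpace ℂ H] [CompleteSpace H]
        (E : Submodule ℂ (H →L[ℂ] H)), IsClosed (E : Set (H →L[ℂ] H)) →
        ∃ (JE : BlockSum n E →ₗ[ℂ] MatEll d m E) (WE : MatEll d m E →ₗ[ℂ] BlockSum n E),
          (∀ (x : BlockSum n ℂ) (e : E),
            JE (fun i a b => x i a b • e) = fun a b j => J x a b j • e) ∧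
          (∀ (y : MatEll d m ℂ) (e : E),
            WE (fun a b j => y a b j • e) = fun i a b => W y i a b • e) ∧
          CompleteIsometry (schattenSumNorm p n (subspaceNorm E))
            (schattenEllNorm q p d m (subspaceNorm E)) JE ∧
          CompletelyContractive (schattenEllNorm q p d m (subspaceNorm E))
            (schattenSumNorm p n (subspaceNorm E)) WE ∧
          WE ∘ₗ JE = LinearMap.id ∧
          CompletelyComplemented (schattenEllNorm q p d m (subspaceNorm E))
            (LinearMap.range JE) := by
  have hd₀ : 0 < d := Nat.pos_of_ne_zero fun h => by
    simpa [(hn _).ne'] using Finset.lcm_eq_zero_iff.1 (hd.symm.trans h)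
  obtain ⟨J, W, hJpos, hWpos, hJ, hW, hWJ, vector⟩ := theorem1p1_general p q hp hq n hn d m hd₀
    (fun i => hd ▸ Finset.dvd_lcm (Finset.mem_univ i)) hm
  exact ⟨J, W, hJpos, hWpos, hJ, hW, hWJ, fun H _ _ _ E _ =>
    vector E (subspaceNorm E) (isOperatorSpace_subspaceNorm E)⟩
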